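/- Let $d\ge 2$ be an integer and let $r\in\mathbb{C}$. Let $\hat{\mathfrak h}$ be the complex Lie algebra with basis $\{v^i(m) : 1\le i\le d,\ m\in\mathbb{Z}\}\cup\{\mathbf c\}$, where $\mathbf c$ is central and $[v^i(m),v^j(n)]=\delta_{m+n,0}\,\delta_{i,j}\,m\,\mathbf c$. In $U(\hat{\mathfrak h})/\langle \mathbf c-1\rangle$ put $v^{ij}(m,n):=v^i(m)v^j(n)$, let $$\mathcal B:=\{v^{ii}(m,n) : 1\le i\le d,\ m\le n\}\cup\{v^{ij}(m,n) : 1\le i<j\le d,\ m,n\in\mathbb{Z}\},$$ and let $\mathcal L:=(\operatorname{Span}_{\mathbb C}\mathcal B)\oplus\mathbb{C}1$, which is closed under commutators. Let $\pi_1:\mathcal L\to\operatorname{Span}_{\mathbb C}\mathcal B$ and $\pi_2:\mathcal L\to\mathbb{C}$ be the two projections, and let $\mathcal L_r$ be the Lie algebra $\mathcal L$ with the bracket $[x,y]_r:=\pi_1([x,y])+r\,\pi_2([x,y])$, where $[x,y]=xy-yx$. Let $\mathcal B_+$ be the set of those $v^{ij}(m,n)\in\mathcal B$ with $m\ge 0$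 or $n\ge 0$, and let $\mathcal L_r^+:=(\operatorname{Span}_{\mathbb C}\mathcal B_+)\oplus\mathbb{C}$, a Lie subalgebra of $\mathcal L_r$. Let $\mathbb{C}\mathbf 1$ be the one-dimensional $\mathcal L_r^+$-module with $x\cdot\mathbf 1=0$ for $x\in\mathcal B_+$ and $s\cdot\mathbf 1=s\mathbf 1$ for $s\in\mathbb{C}$, and let $M_r:=U(\mathcal L_r)\otimes_{U(\mathcal L_r^+)}\mathbb{C}\mathbf 1$ be the induced $\mathcal L_r$-module. Let $\mathcal L_r^{(1)}$ be the Lie subalgebra of $\mathcal L_r$ generated by $\{v^{11}(m,n) : m,n\in\mathbb{Z},\ m\le n\}$, and let $M_r^{(1)}:=U(\mathcal L_r^{(1)})\mathbf 1\subset M_r$. If $r\notin\mathbb{Z}$, then $M_r^{(1)}$ is an irreducible $\mathcal L_r^{(1)}$-module. -/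

import Mathlib

noncomputable section

namespace AshiharaMiyamoto

attribute [local instance 100] LieRing.ofAssociativeRing

/-! ### The Heisenberg Lie algebra -/

/-- The vector space with basis `v^i(m)` (`i : Fin d`, `m : ℤ`) together with `c`:
finitely supported coordinates along the `v^i(m)`, and one coordinate along `c`. -/
def Heis (d : ℕ) : Type := ((Fin d × ℤ) →₀ ℂ) × ℂ

instance (d : ℕ) : AddCommGroup (Heis d) :=
  inferInstanceAs (AddCommGroup (((Fin d × ℤ) →₀ ℂ) × ℂ))

instance (d : ℕ) : Module ℂ (Heis d) :=
  inferInstanceAs (Module ℂ (((Fin d × ℤ) →₀ ℂ) × ℂ))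

/-- The bilinear form with `⟨v^i(m), v^j(n)⟩ = δ_{m+n,0} δ_{i,j} m`. -/
def heisForm (d : ℕ) : ((Fin d × ℤ) →₀ ℂ) →ₗ[ℂ] ((Fin d × ℤ) →₀ ℂ) →ₗ[ℂ] ℂ :=
  Finsupp.linearCombination ℂ
    (fun p : Fin d × ℤ => (p.2 : ℂ) • Finsupp.lapply (R := ℂ) (M := ℂ) (p.1, -p.2))

/-- The scalar `δ_{m+n,0} δ_{i,j} m`. -/
def heisCoeff {d : ℕ} (i j : Fin d) (m n : ℤ) : ℂ := if i = j ∧ m + n = 0 then (m : ℂ) else 0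

theorem heisForm_single {d : ℕ} (i j : Fin d) (m n : ℤ) :
    heisForm d (Finsupp.single (i, m) 1) (Finsupp.single (j, n) 1) = heisCoeff i j m n := by
  simp only [heisForm, Finsupp.linearCombination_single, one_smul, LinearMap.smul_apply,
    Finsupp.lapply_apply, Finsupp.single_apply, Prod.mk.injEq, smul_eq_mul, heisCoeff]
  by_cases h : i = j ∧ m + n = 0
  · have h' : j = i ∧ n = -m := ⟨h.1.symm, by omega⟩
    rw [if_pos h, if_pos h', mul_one]
  · have h' : ¬ (j = i ∧ n = -m) := fun h' => h ⟨h'.1.symm, by omega⟩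
    rw [if_neg h, if_neg h', mul_zero]

theorem heisForm_skew {d : ℕ} (x y : (Fin d × ℤ) →₀ ℂ) : heisForm d x y = -heisForm d y x := by
  have : heisForm d = -(heisForm d).flip := by
    refine Finsupp.lhom_ext' fun p => LinearMap.ext_ring (Finsupp.lhom_ext' fun q =>
      LinearMap.ext_ring ?_)
    obtain ⟨i, m⟩ := p
    obtain ⟨j, n⟩ := q
    simp only [LinearMap.coe_comp, Function.comp_apply, Finsupp.lsingle_apply,
      LinearMap.neg_apply, LinearMap.flip_apply, heisForm_single, heisCoeff]
    by_cases h : i = j ∧ m + n = 0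
    · have h' : j = i ∧ n + m = 0 := ⟨h.1.symm, by omega⟩
      have h2 : m = -n := by omega
      rw [if_pos h, if_pos h', h2]
      simp
    · have h' : ¬ (j = i ∧ n + m = 0) := fun h' => h ⟨h'.1.symm, by omega⟩
      rw [if_neg h, if_neg h', neg_zero]
  conv_lhs => rw [this]
  simp

theorem heisForm_self {d : ℕ} (x : (Fin d × ℤ) →₀ ℂ) : heisForm d x x = 0 := by
  have := heisForm_skew x x
  exact self_eq_neg.mp this

/-- The Lie bracket of the Heisenberg algebra:
`[v^i(m), v^j(n)] = δ_{m+n,0} δ_{i,j} m c`, with `c` central. -/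
instance (d : ℕ) : LieRing (Heis d) where
  bracket x y := ((0, heisForm d x.1 y.1) : ((Fin d × ℤ) →₀ ℂ) × ℂ)
  add_lie x y z := by
    refine Prod.ext (add_zero (0 : (Fin d × ℤ) →₀ ℂ)).symm ?_
    change heisForm d (x.1 + y.1) z.1 = heisForm d x.1 z.1 + heisForm d y.1 z.1
    simp
  lie_add x y z := by
    refine Prod.ext (add_zero (0 : (Fin d × ℤ) →₀ ℂ)).symm ?_
    change heisForm d x.1 (y.1 + z.1) = heisForm d x.1 y.1 + heisForm d x.1 z.1
    simp
  lie_self x := Prod.ext rfl (heisForm_self x.1)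
  leibniz_lie x y z := by
    refine Prod.ext (add_zero (0 : (Fin d × ℤ) →₀ ℂ)).symm ?_
    change heisForm d x.1 0 = heisForm d 0 z.1 + heisForm d y.1 0
    simp

instance (d : ℕ) : LieAlgebra ℂ (Heis d) where
  lie_smul t x y := by
    refine Prod.ext ?_ ?_
    · change (0 : (Fin d × ℤ) →₀ ℂ) = t • 0
      simp
    · change heisForm d x.1 (t • y.1) = t • heisForm d x.1 y.1
      simp

/-- The basis vector `v^i(m)`. -/
def heisV {d : ℕ} (i : Fin d) (m : ℤ) : Heis d :=
  ((Finsupp.single (i, m) 1, 0) : ((Fin d × ℤ) →₀ ℂ) × ℂ)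

/-- The basis vector `c`. -/
def heisC (d : ℕ) : Heis d := ((0, 1) : ((Fin d × ℤ) →₀ ℂ) × ℂ)

theorem heisV_lie {d : ℕ} (i j : Fin d) (m n : ℤ) :
    ⁅heisV i m, heisV j n⁆ = heisCoeff i j m n • heisC d := by
  refine Prod.ext ?_ ?_
  · change (0 : (Fin d × ℤ) →₀ ℂ) = heisCoeff i j m n • 0
    simp
  · change heisForm d (Finsupp.single (i, m) 1) (Finsupp.single (j, n) 1)
      = heisCoeff i j m n • (1 : ℂ)
    rw [heisForm_single]
    simp

/-! ### The quotient of the enveloping algebra by `c - 1`, and the subspace `𝓛` -/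

/-- The relation identifying `c` with `1` in the enveloping algebra. -/
inductive CentralRel (d : ℕ) :
    UniversalEnvelopingAlgebra ℂ (Heis d) → UniversalEnvelopingAlgebra ℂ (Heis d) → Prop
  | c_eq_one : CentralRel d (UniversalEnvelopingAlgebra.ι ℂ (heisC d)) 1

/-- `U(ĥ)/⟨c - 1⟩`, the quotient by the two-sided ideal generated by `c - 1`. -/
abbrev HeisU (d : ℕ) : Type := RingQuot (CentralRel d)

/-- The class of `v^i(m)` in `U(ĥ)/⟨c - 1⟩`. -/
def gen {d : ℕ} (i : Fin d) (m : ℤ) : HeisU d :=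
  RingQuot.mkAlgHom ℂ (CentralRel d) (UniversalEnvelopingAlgebra.ι ℂ (heisV i m))

/-- `v^{ij}(m,n) = v^i(m) v^j(n)` in `U(ĥ)/⟨c - 1⟩`. -/
def vv {d : ℕ} (i j : Fin d) (m n : ℤ) : HeisU d := gen i m * gen j n

/-- The set `𝓑`. -/
def setB (d : ℕ) : Set (HeisU d) :=
  {x | ∃ (i : Fin d) (m n : ℤ), m ≤ n ∧ x = vv i i m n} ∪
    {x | ∃ (i j : Fin d) (m n : ℤ), i < j ∧ x = vv i j m n}

/-- The set `𝓑₊` of the `v^{ij}(m,n) ∈ 𝓑` with `m ≥ 0` or `n ≥ 0`. -/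
def setBplus (d : ℕ) : Set (HeisU d) :=
  {x | ∃ (i : Fin d) (m n : ℤ), m ≤ n ∧ (0 ≤ m ∨ 0 ≤ n) ∧ x = vv i i m n} ∪
    {x | ∃ (i j : Fin d) (m n : ℤ), i < j ∧ (0 ≤ m ∨ 0 ≤ n) ∧ x = vv i j m n}

/-- The subspace `𝓛 = Span 𝓑 + ℂ` of `U(ĥ)/⟨c - 1⟩`; the sum is direct, see `isCompl_spanB`. -/
def calL (d : ℕ) : Submodule ℂ (HeisU d) := Submodule.span ℂ (setB d) ⊔ Submodule.span ℂ {1}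

theorem one_mem_calL (d : ℕ) : (1 : HeisU d) ∈ calL d :=
  Submodule.mem_sup_right (Submodule.mem_span_singleton_self 1)

/-- The subspace `Span 𝓑` of `𝓛`. -/
def spanB (d : ℕ) : Submodule ℂ (calL d) := Submodule.span ℂ {x | (x : HeisU d) ∈ setB d}

/-- The element `1` of `𝓛`. -/
def oneL (d : ℕ) : calL d := ⟨1, one_mem_calL d⟩

theorem gen_mul_comm {d : ℕ} (i j : Fin d) (m n : ℤ) :
    gen i m * gen j n = gen j n * gen i m + heisCoeff i j m n • (1 : HeisU d) := by
  have hc : RingQuot.mkAlgHom ℂ (CentralRel d) (UniversalEnvelopingAlgebra.ι ℂ (heisC d)) = 1 := by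
    rw [RingQuot.mkAlgHom_rel ℂ CentralRel.c_eq_one, map_one]
  have h := (UniversalEnvelopingAlgebra.ι ℂ).map_lie (heisV i m) (heisV j n)
  rw [heisV_lie, map_smul, LieRing.of_associative_ring_bracket] at h
  have h2 := congrArg (RingQuot.mkAlgHom ℂ (CentralRel d)) h
  rw [map_smul, hc, map_sub, map_mul, map_mul] at h2
  rw [h2]
  simp [gen]

/-! ### The Fock representation, used to see that `1 ∉ Span 𝓑` -/

/-- The operator of `v^i(m)` on polynomials in variables `X (i, k)`. -/
def fockOp {d : ℕ} (i : Fin d) (m : ℤ) : Module.End ℂ (MvPolynomial (Fin d × ℤ) ℂ) :=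
  if m < 0 then LinearMap.mulLeft ℂ (MvPolynomial.X (i, -m))
  else (m : ℂ) • (MvPolynomial.pderiv (i, m)).toLinearMap

theorem pderiv_comm {σ : Type*} (a b : σ) (f : MvPolynomial σ ℂ) :
    MvPolynomial.pderiv a (MvPolynomial.pderiv b f) =
      MvPolynomial.pderiv b (MvPolynomial.pderiv a f) := by
  classical
  have hb : ⁅MvPolynomial.pderiv (R := ℂ) a, MvPolynomial.pderiv (R := ℂ) b⁆ = 0 := by
    apply MvPolynomial.derivation_ext
    intro k
    simp only [Derivation.commutator_apply, MvPolynomial.pderiv_X, Pi.single_apply,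
      Derivation.zero_apply]
    split_ifs <;> simp
  have h := Derivation.congr_fun hb f
  rwa [Derivation.commutator_apply, Derivation.zero_apply, sub_eq_zero] at h

theorem fockOp_comm {d : ℕ} (i j : Fin d) (m n : ℤ) :
    fockOp i m * fockOp j n - fockOp j n * fockOp i m = heisCoeff i j m n • 1 := by
  have key : ∀ (i j : Fin d) (m n : ℤ), m < 0 → ¬ n < 0 →
      fockOp i m * fockOp j n - fockOp j n * fockOp i m = heisCoeff i j m n • 1 := by
    intro i j m n hm hn
    refine LinearMap.ext fun f => ?_
    simp only [fockOp, hm, hn, if_true, if_false, LinearMap.sub_apply, Module.End.mul_apply,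
      LinearMap.mulLeft_apply, LinearMap.smul_apply, Derivation.coeFn_coe, Derivation.leibniz,
      MvPolynomial.pderiv_X, heisCoeff, Module.End.one_apply, smul_eq_mul]
    by_cases h : i = j ∧ m + n = 0
    · obtain ⟨rfl, h⟩ := h
      have hn' : n = -m := by omega
      subst hn'
      simp [smul_add, MvPolynomial.smul_eq_C_mul]
      ring
    · have h' : ¬ (i, -m) = (j, n) := by
        intro h'
        simp only [Prod.mk.injEq] at h'
        exact h ⟨h'.1, by omega⟩
      simp [h, MvPolynomial.smul_eq_C_mul, h']
      ring
  by_cases hm : m < 0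
  · by_cases hn : n < 0
    · have : ¬ (i = j ∧ m + n = 0) := by omega
      refine LinearMap.ext fun f => ?_
      simp only [fockOp, hm, hn, if_true, LinearMap.sub_apply, Module.End.mul_apply,
        LinearMap.mulLeft_apply, heisCoeff, this, if_false, zero_smul, LinearMap.zero_apply]
      ring
    · exact key i j m n hm hn
  · by_cases hn : n < 0
    · have h := key j i n m hn hm
      have h3 : heisCoeff i j m n = - heisCoeff j i n m := by
        rw [← heisForm_single, ← heisForm_single, heisForm_skew]
      have h4 : (-heisCoeff j i n m) • (1 : Module.End ℂ (MvPolynomial (Fin d × ℤ) ℂ)) =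
          -(heisCoeff j i n m • 1) := by module
      rw [h3, h4, ← h, neg_sub]
    · have h0 : heisCoeff i j m n = 0 := by
        unfold heisCoeff
        split_ifs with h
        · have : m = 0 := by omega
          simp [this]
        · rfl
      rw [h0, zero_smul, sub_eq_zero]
      refine LinearMap.ext fun f => ?_
      simp only [fockOp, hm, hn, if_false, Module.End.mul_apply, LinearMap.smul_apply,
        Derivation.coeFn_coe, map_smul]
      rw [smul_comm, pderiv_comm]

/-- The Fock representation of the Heisenberg Lie algebra, with `c` acting as `1`. -/
def fockLie (d : ℕ) : Heis d →ₗ⁅ℂ⁆ Module.End ℂ (MvPolynomial (Fin d × ℤ) ℂ) where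
  toLinearMap := LinearMap.coprod
    (Finsupp.linearCombination ℂ (fun p : Fin d × ℤ => fockOp p.1 p.2))
    (LinearMap.toSpanSingleton ℂ (Module.End ℂ (MvPolynomial (Fin d × ℤ) ℂ)) 1)
  map_lie' := by
    intro x y
    obtain ⟨x, a⟩ := x
    obtain ⟨y, b⟩ := y
    set F := Finsupp.linearCombination ℂ (fun p : Fin d × ℤ => fockOp p.1 p.2)
    change F 0 + heisForm d x y • 1 = ⁅F x + a • 1, F y + b • 1⁆
    have hF : ∀ x y, F x * F y - F y * F x = heisForm d x y • 1 := by
      intro x y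
      have : (LinearMap.mul ℂ (Module.End ℂ (MvPolynomial (Fin d × ℤ) ℂ))).compl₁₂ F F =
          (LinearMap.mul ℂ (Module.End ℂ (MvPolynomial (Fin d × ℤ) ℂ))).flip.compl₁₂ F F +
          (heisForm d).compr₂ (LinearMap.toSpanSingleton ℂ
            (Module.End ℂ (MvPolynomial (Fin d × ℤ) ℂ)) 1) := by
        refine Finsupp.lhom_ext' fun p => LinearMap.ext_ring (Finsupp.lhom_ext' fun q =>
          LinearMap.ext_ring ?_)
        obtain ⟨i, m⟩ := p
        obtain ⟨j, n⟩ := q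
        have := fockOp_comm i j m n
        rw [sub_eq_iff_eq_add'] at this
        simpa [F, heisForm_single] using this
      have := LinearMap.congr_fun₂ this x y
      rw [sub_eq_iff_eq_add']
      simpa using this
    rw [map_zero, zero_add, ← hF, LieRing.of_associative_ring_bracket]
    simp only [add_mul, mul_add, smul_mul_assoc, mul_smul_comm, one_mul, mul_one]
    module

/-- The Fock representation of `U(ĥ)/⟨c - 1⟩`. -/
def fock (d : ℕ) : HeisU d →ₐ[ℂ] Module.End ℂ (MvPolynomial (Fin d × ℤ) ℂ) :=
  RingQuot.liftAlgHom ℂ ⟨UniversalEnvelopingAlgebra.lift ℂ (fockLie d), by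
    rintro _ _ ⟨⟩
    rw [UniversalEnvelopingAlgebra.lift_ι_apply, map_one]
    change Finsupp.linearCombination ℂ (fun p : Fin d × ℤ => fockOp p.1 p.2) 0 + (1 : ℂ) • 1 = 1
    simp⟩

theorem fock_gen {d : ℕ} (i : Fin d) (m : ℤ) : fock d (gen i m) = fockOp i m := by
  rw [fock, gen, RingQuot.liftAlgHom_mkAlgHom_apply, UniversalEnvelopingAlgebra.lift_ι_apply]
  change Finsupp.linearCombination ℂ (fun p : Fin d × ℤ => fockOp p.1 p.2)
    (Finsupp.single (i, m) 1) + (0 : ℂ) • 1 = fockOp i m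
  simp

/-- The vacuum expectation. -/
def vev (d : ℕ) : HeisU d →ₗ[ℂ] ℂ :=
  (MvPolynomial.aeval (fun _ : Fin d × ℤ => (0 : ℂ))).toLinearMap ∘ₗ
    (LinearMap.applyₗ (1 : MvPolynomial (Fin d × ℤ) ℂ)) ∘ₗ (fock d).toLinearMap

theorem vev_apply {d : ℕ} (x : HeisU d) :
    vev d x = MvPolynomial.aeval (fun _ : Fin d × ℤ => (0 : ℂ)) (fock d x 1) := rfl

theorem vev_one (d : ℕ) : vev d 1 = 1 := by simp [vev]

theorem fock_Bplus {d : ℕ} {x : HeisU d} (hx : x ∈ setBplus d) : fock d x 1 = 0 := by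
  have h1 : ∀ (i : Fin d) (m : ℤ), 0 ≤ m → fockOp i m 1 = 0 := by
    intro i m hm
    simp [fockOp, not_lt.mpr hm]
  rcases hx with ⟨i, m, n, hmn, h, rfl⟩ | ⟨i, j, m, n, hij, h, rfl⟩
  · rw [vv, map_mul, fock_gen, fock_gen, Module.End.mul_apply, h1 i n (by omega), map_zero]
  · rw [vv, map_mul, fock_gen, fock_gen, Module.End.mul_apply]
    by_cases hn : 0 ≤ n
    · rw [h1 j n hn, map_zero]
    · have h2 := congrArg (fun G => G 1) (fockOp_comm i j m n)
      simp only [LinearMap.sub_apply, Module.End.mul_apply] at h2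
      rw [h1 i m (by omega), map_zero, sub_zero] at h2
      rw [h2]
      simp [heisCoeff, hij.ne]

theorem vev_B {d : ℕ} {x : HeisU d} (hx : x ∈ setB d) : vev d x = 0 := by
  have key : ∀ (i j : Fin d) (m n : ℤ), m < 0 → n < 0 → vev d (vv i j m n) = 0 := by
    intro i j m n hm hn
    simp [vev, vv, fock_gen, fockOp, hm, hn]
  rcases hx with ⟨i, m, n, hmn, rfl⟩ | ⟨i, j, m, n, hij, rfl⟩
  · by_cases h : 0 ≤ m ∨ 0 ≤ n
    · have := fock_Bplus (Or.inl ⟨i, m, n, hmn, h, rfl⟩ : vv i i m n ∈ setBplus d)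
      simp [vev, this]
    · exact key _ _ _ _ (by omega) (by omega)
  · by_cases h : 0 ≤ m ∨ 0 ≤ n
    · have := fock_Bplus (Or.inr ⟨i, j, m, n, hij, h, rfl⟩ : vv i j m n ∈ setBplus d)
      simp [vev, this]
    · exact key _ _ _ _ (by omega) (by omega)

theorem oneL_ne_zero (d : ℕ) : oneL d ≠ 0 := by
  intro h
  have h2 : (1 : HeisU d) = 0 := congrArg Subtype.val h
  have := vev_one d
  rw [h2, map_zero] at this
  exact zero_ne_one this

theorem vev_spanB {d : ℕ} {x : calL d} (hx : x ∈ spanB d) : vev d x = 0 := by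
  induction hx using Submodule.span_induction with
  | mem x h => exact vev_B h
  | zero => simp
  | add x y _ _ hx hy => simp [hx, hy]
  | smul a x _ hx => simp [hx]

/-- `𝓛 = (Span 𝓑) ⊕ ℂ`. -/
theorem isCompl_spanB (d : ℕ) : IsCompl (spanB d) (Submodule.span ℂ {oneL d}) := by
  refine IsCompl.of_le ?_ ?_
  · rintro x ⟨h1, h2⟩
    obtain ⟨a, rfl⟩ := Submodule.mem_span_singleton.mp h2
    have := vev_spanB h1
    have ha : a = 0 := by simpa [oneL, vev_one] using this
    simp [ha]
  · rintro ⟨x, hx⟩ -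
    obtain ⟨y, hy, z, hz, rfl⟩ := Submodule.mem_sup.mp hx
    obtain ⟨a, rfl⟩ := Submodule.mem_span_singleton.mp hz
    have hy' : ∀ y, y ∈ Submodule.span ℂ (setB d) → ∀ h : y ∈ calL d,
        (⟨y, h⟩ : calL d) ∈ spanB d := by
      intro y hy
      induction hy using Submodule.span_induction with
      | mem x hx => exact fun h => Submodule.subset_span hx
      | zero => exact fun h => Submodule.zero_mem _
      | add x y hx hy ihx ihy =>
        exact fun h => Submodule.add_mem _ (ihx (Submodule.mem_sup_left hx))
          (ihy (Submodule.mem_sup_left hy))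
      | smul a x hx ih => exact fun h => Submodule.smul_mem _ a (ih (Submodule.mem_sup_left hx))
    exact Submodule.mem_sup.mpr ⟨⟨y, Submodule.mem_sup_left hy⟩, hy' y hy _, a • oneL d,
      Submodule.smul_mem _ a (Submodule.mem_span_singleton_self _), rfl⟩

/-- The projection `π₁ : 𝓛 → Span 𝓑` along `ℂ`, with values regarded in `𝓛`. -/
def proj1 (d : ℕ) : calL d →ₗ[ℂ] calL d :=
  (spanB d).subtype ∘ₗ Submodule.projectionOnto _ _ (isCompl_spanB d)

/-- The projection `π₂ : 𝓛 → ℂ` along `Span 𝓑`. -/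
def proj2 (d : ℕ) : calL d →ₗ[ℂ] ℂ :=
  LinearMap.ofIsCompl (isCompl_spanB d) 0
    (LinearEquiv.coord ℂ (calL d) (oneL d) (oneL_ne_zero d)).toLinearMap

theorem proj2_spanB {d : ℕ} {x : calL d} (hx : x ∈ spanB d) : proj2 d x = 0 :=
  LinearMap.ofIsCompl_apply_left (isCompl_spanB d) ⟨x, hx⟩

theorem proj2_one (d : ℕ) : proj2 d (oneL d) = 1 := by
  have := LinearMap.ofIsCompl_apply_right (isCompl_spanB d)
    (φ := (0 : _ →ₗ[ℂ] ℂ)) (ψ := (LinearEquiv.coord ℂ (calL d) (oneL d)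
      (oneL_ne_zero d)).toLinearMap) ⟨oneL d, Submodule.mem_span_singleton_self _⟩
  rw [proj2]
  refine this.trans ?_
  exact LinearEquiv.coord_self ℂ (calL d) (oneL d) (oneL_ne_zero d)

theorem proj2_eq_vev {d : ℕ} (x : calL d) : proj2 d x = vev d x := by
  have hx : x ∈ spanB d ⊔ Submodule.span ℂ {oneL d} := by
    rw [(isCompl_spanB d).sup_eq_top]
    trivial
  obtain ⟨y, hy, z, hz, rfl⟩ := Submodule.mem_sup.mp hx
  obtain ⟨a, rfl⟩ := Submodule.mem_span_singleton.mp hz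
  have h1 : vev d (oneL d : HeisU d) = 1 := vev_one d
  simp [proj2_spanB hy, proj2_one, vev_spanB hy, h1]

theorem proj1_add_proj2 {d : ℕ} (x : calL d) : proj1 d x + proj2 d x • oneL d = x := by
  have hx : x ∈ spanB d ⊔ Submodule.span ℂ {oneL d} := by
    rw [(isCompl_spanB d).sup_eq_top]
    trivial
  obtain ⟨y, hy, z, hz, rfl⟩ := Submodule.mem_sup.mp hx
  obtain ⟨a, rfl⟩ := Submodule.mem_span_singleton.mp hz
  have h1 : proj1 d y = y := by
    have := Submodule.projectionOnto_apply_left (isCompl_spanB d) ⟨y, hy⟩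
    exact congrArg Subtype.val this
  have h2 : proj1 d (oneL d) = 0 := by
    rw [proj1, LinearMap.comp_apply, (Submodule.projectionOnto_apply_eq_zero_iff _).mpr
      (Submodule.mem_span_singleton_self _), map_zero]
  simp [h1, h2, proj2_spanB hy, proj2_one]

/-! ### Commutators in `𝓛` -/

theorem comm_mem_span {A : Type*} [Ring A] [Algebra ℂ A] {T : Set A} {P : Submodule ℂ A}
    (hT : ∀ x ∈ T, ∀ y ∈ T, x * y - y * x ∈ P) {x y : A}
    (hx : x ∈ Submodule.span ℂ T) (hy : y ∈ Submodule.span ℂ T) : x * y - y * x ∈ P := by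
  induction hx, hy using Submodule.span_induction₂ with
  | mem_mem x y hx hy => exact hT x hx y hy
  | zero_left y hy => simp
  | zero_right x hx => simp
  | add_left x y z _ _ _ h1 h2 =>
    have : (x + y) * z - z * (x + y) = (x * z - z * x) + (y * z - z * y) := by noncomm_ring
    rw [this]
    exact add_mem h1 h2
  | add_right x y z _ _ _ h1 h2 =>
    have : x * (y + z) - (y + z) * x = (x * y - y * x) + (x * z - z * x) := by noncomm_ring
    rw [this]
    exact add_mem h1 h2
  | smul_left a x y _ _ h =>
    rw [smul_mul_assoc, mul_smul_comm, ← smul_sub]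
    exact P.smul_mem a h
  | smul_right a x y _ _ h =>
    rw [smul_mul_assoc, mul_smul_comm, ← smul_sub]
    exact P.smul_mem a h

theorem vv_comm {d : ℕ} (i j k l : Fin d) (m n p q : ℤ) :
    vv i j m n * vv k l p q - vv k l p q * vv i j m n =
      heisCoeff j k n p • vv i l m q + heisCoeff i k m p • vv j l n q +
        heisCoeff j l n q • vv k i p m + heisCoeff i l m q • vv k j p n := by
  have h : ∀ (k : Fin d) (p : ℤ), gen i m * gen j n * gen k p =
      gen k p * (gen i m * gen j n) + heisCoeff j k n p • gen i m +
        heisCoeff i k m p • gen j n := by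
    intro k p
    rw [mul_assoc, gen_mul_comm j k n p, mul_add, ← mul_assoc, gen_mul_comm i k m p, add_mul,
      mul_assoc]
    simp only [mul_smul_comm, smul_mul_assoc, mul_one, one_mul]
    abel
  simp only [vv]
  rw [← mul_assoc, h k p, add_mul, add_mul, mul_assoc (gen k p), h l q]
  simp only [mul_add, mul_smul_comm, smul_mul_assoc, mul_assoc]
  abel

/-- Every `v^{ij}(m,n)` lies in `𝓛`. -/
theorem vv_mem_calL {d : ℕ} (i j : Fin d) (m n : ℤ) : vv i j m n ∈ calL d := by
  have hB : ∀ x ∈ setB d, x ∈ calL d := fun x hx =>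
    Submodule.mem_sup_left (Submodule.subset_span hx)
  have hs : vv j i n m ∈ setB d → vv i j m n ∈ calL d := by
    intro h
    rw [vv, gen_mul_comm]
    exact add_mem (hB _ h) (Submodule.smul_mem _ _ (one_mem_calL d))
  rcases lt_trichotomy i j with h | rfl | h
  · exact hB _ (Or.inr ⟨i, j, m, n, h, rfl⟩)
  · rcases le_total m n with h | h
    · exact hB _ (Or.inl ⟨i, m, n, h, rfl⟩)
    · exact hs (Or.inl ⟨i, n, m, h, rfl⟩)
  · exact hs (Or.inr ⟨j, i, n, m, h, rfl⟩)

/-- The subspace `(Span 𝓑₊) + ℂ` of `U(ĥ)/⟨c - 1⟩`. -/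
def calLplus (d : ℕ) : Submodule ℂ (HeisU d) :=
  Submodule.span ℂ (setBplus d) ⊔ Submodule.span ℂ {1}

theorem vv_mem_calLplus {d : ℕ} (i j : Fin d) (m n : ℤ) (hmn : 0 ≤ m ∨ 0 ≤ n) :
    vv i j m n ∈ calLplus d := by
  have hB : ∀ x ∈ setBplus d, x ∈ calLplus d := fun x hx =>
    Submodule.mem_sup_left (Submodule.subset_span hx)
  have hs : vv j i n m ∈ setBplus d → vv i j m n ∈ calLplus d := by
    intro h
    rw [vv, gen_mul_comm]
    exact add_mem (hB _ h) (Submodule.smul_mem _ _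
      (Submodule.mem_sup_right (Submodule.mem_span_singleton_self 1)))
  rcases lt_trichotomy i j with h | rfl | h
  · exact hB _ (Or.inr ⟨i, j, m, n, h, hmn, rfl⟩)
  · rcases le_total m n with h | h
    · exact hB _ (Or.inl ⟨i, m, n, h, hmn, rfl⟩)
    · exact hs (Or.inl ⟨i, n, m, h, hmn.symm, rfl⟩)
  · exact hs (Or.inr ⟨j, i, n, m, h, hmn.symm, rfl⟩)

theorem comm_mem_calL {d : ℕ} {x y : HeisU d} (hx : x ∈ calL d) (hy : y ∈ calL d) :
    x * y - y * x ∈ calL d := by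
  rw [calL, ← Submodule.span_union] at hx hy
  refine comm_mem_span ?_ hx hy
  have hvv : ∀ x ∈ setB d, ∃ i j m n, x = vv i j m n := by
    rintro x (⟨i, m, n, -, h⟩ | ⟨i, j, m, n, -, h⟩)
    · exact ⟨i, i, m, n, h⟩
    · exact ⟨i, j, m, n, h⟩
  rintro x (hx | rfl) y (hy | rfl)
  · obtain ⟨i, j, m, n, rfl⟩ := hvv x hx
    obtain ⟨k, l, p, q, rfl⟩ := hvv y hy
    rw [vv_comm]
    exact add_mem (add_mem (add_mem (Submodule.smul_mem _ _ (vv_mem_calL _ _ _ _))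
      (Submodule.smul_mem _ _ (vv_mem_calL _ _ _ _))) (Submodule.smul_mem _ _ (vv_mem_calL _ _ _ _)))
      (Submodule.smul_mem _ _ (vv_mem_calL _ _ _ _))
  all_goals simp

theorem comm_mem_calLplus {d : ℕ} {x y : HeisU d} (hx : x ∈ calLplus d) (hy : y ∈ calLplus d) :
    x * y - y * x ∈ calLplus d := by
  rw [calLplus, ← Submodule.span_union] at hx hy
  refine comm_mem_span ?_ hx hy
  have hvv : ∀ x ∈ setBplus d, ∃ i j m n, (0 ≤ m ∨ 0 ≤ n) ∧ x = vv i j m n := by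
    rintro x (⟨i, m, n, -, h⟩ | ⟨i, j, m, n, -, h⟩)
    · exact ⟨i, i, m, n, h⟩
    · exact ⟨i, j, m, n, h⟩
  have hterm : ∀ (i j k l : Fin d) (a b e f : ℤ), (0 ≤ a ∨ 0 ≤ b) → (0 ≤ e ∨ 0 ≤ f) →
      heisCoeff i j a e • vv k l b f ∈ calLplus d ∧ heisCoeff i j a e • vv k l f b ∈ calLplus d := by
    intro i j k l a b e f h1 h2
    by_cases h : (i = j ∧ a + e = 0) ∧ a ≠ 0
    · exact ⟨Submodule.smul_mem _ _ (vv_mem_calLplus _ _ _ _ (by omega)),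
        Submodule.smul_mem _ _ (vv_mem_calLplus _ _ _ _ (by omega))⟩
    · have h0 : heisCoeff i j a e = 0 := by
        unfold heisCoeff
        split_ifs with h'
        · have : a = 0 := by
            by_contra hne
            exact h ⟨h', hne⟩
          simp [this]
        · rfl
      simp [h0]
  rintro x (hx | rfl) y (hy | rfl)
  · obtain ⟨i, j, m, n, h1, rfl⟩ := hvv x hx
    obtain ⟨k, l, p, q, h2, rfl⟩ := hvv y hy
    rw [vv_comm]
    exact add_mem (add_mem (add_mem (hterm _ _ _ _ _ _ _ _ h1.symm h2).1
      (hterm _ _ _ _ _ _ _ _ h1 h2).1) (hterm _ _ _ _ _ _ _ _ h1.symm h2.symm).2)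
      (hterm _ _ _ _ _ _ _ _ h1 h2.symm).2
  all_goals simp

/-! ### The Lie algebra `𝓛_r` -/

/-- The ordinary commutator on `𝓛`. -/
def commL {d : ℕ} (x y : calL d) : calL d :=
  ⟨(x : HeisU d) * y - y * x, comm_mem_calL x.2 y.2⟩

/-- The underlying space of `𝓛_r` is `𝓛`. -/
def LieLr (d : ℕ) (_r : ℂ) : Type := calL d

instance (d : ℕ) (r : ℂ) : AddCommGroup (LieLr d r) := inferInstanceAs (AddCommGroup (calL d))

instance (d : ℕ) (r : ℂ) : Module ℂ (LieLr d r) := inferInstanceAs (Module ℂ (calL d))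

/-- The identification of `𝓛` with the underlying space of `𝓛_r`. -/
def toLr {d : ℕ} (r : ℂ) : calL d ≃ₗ[ℂ] LieLr d r := LinearEquiv.refl ℂ (calL d)

/-- `π₁([x,y]) + r π₂([x,y])`. -/
def bracketr {d : ℕ} (r : ℂ) (x y : calL d) : calL d :=
  proj1 d (commL x y) + (r * proj2 d (commL x y)) • oneL d

theorem bracketr_eq {d : ℕ} (r : ℂ) (x y : calL d) :
    bracketr r x y = commL x y + ((r - 1) * proj2 d (commL x y)) • oneL d := by
  have := proj1_add_proj2 (commL x y)
  rw [bracketr]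
  nth_rewrite 3 [← this]
  module

theorem commL_bracketr_right {d : ℕ} (r : ℂ) (x y z : calL d) :
    commL x (bracketr r y z) = commL x (commL y z) := by
  rw [bracketr_eq]
  apply Subtype.ext
  simp [commL, oneL, mul_add, add_mul]

theorem commL_bracketr_left {d : ℕ} (r : ℂ) (x y z : calL d) :
    commL (bracketr r x y) z = commL (commL x y) z := by
  rw [bracketr_eq]
  apply Subtype.ext
  simp [commL, oneL, mul_add, add_mul]

theorem bracketr_add_left {d : ℕ} (r : ℂ) (x y z : calL d) :
    bracketr r (x + y) z = bracketr r x z + bracketr r y z := by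
  have h : commL (x + y) z = commL x z + commL y z :=
    Subtype.ext (by simp [commL]; noncomm_ring)
  simp only [bracketr, h, map_add]
  module

theorem bracketr_add_right {d : ℕ} (r : ℂ) (x y z : calL d) :
    bracketr r x (y + z) = bracketr r x y + bracketr r x z := by
  have h : commL x (y + z) = commL x y + commL x z :=
    Subtype.ext (by simp [commL]; noncomm_ring)
  simp only [bracketr, h, map_add]
  module

theorem bracketr_smul_right {d : ℕ} (r t : ℂ) (x y : calL d) :
    bracketr r x (t • y) = t • bracketr r x y := by
  have h : commL x (t • y) = t • commL x y := Subtype.ext (by simp [commL, smul_sub])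
  simp only [bracketr, h, map_smul, smul_eq_mul]
  module

theorem bracketr_self {d : ℕ} (r : ℂ) (x : calL d) : bracketr r x x = 0 := by
  have h : commL x x = 0 := Subtype.ext (by simp [commL])
  simp [bracketr, h]

theorem bracketr_leibniz {d : ℕ} (r : ℂ) (x y z : calL d) :
    bracketr r x (bracketr r y z) =
      bracketr r (bracketr r x y) z + bracketr r y (bracketr r x z) := by
  have h : commL x (commL y z) = commL (commL x y) z + commL y (commL x z) :=
    Subtype.ext (by simp [commL]; noncomm_ring)
  have h1 : commL x (bracketr r y z) =
      commL (bracketr r x y) z + commL y (bracketr r x z) := by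
    rw [commL_bracketr_right, commL_bracketr_left, commL_bracketr_right, h]
  rw [bracketr, h1, map_add, map_add]
  conv_rhs => rw [bracketr, bracketr.eq_def r y]
  module

/-- The Lie bracket `[x,y]_r = π₁([x,y]) + r π₂([x,y])`. -/
instance (d : ℕ) (r : ℂ) : LieRing (LieLr d r) where
  bracket x y := toLr r (bracketr r ((toLr r).symm x) ((toLr r).symm y))
  add_lie x y z := bracketr_add_left (d := d) r x y z
  lie_add x y z := bracketr_add_right (d := d) r x y z
  lie_self x := bracketr_self (d := d) r x
  leibniz_lie x y z := bracketr_leibniz (d := d) r x y z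

instance (d : ℕ) (r : ℂ) : LieAlgebra ℂ (LieLr d r) where
  lie_smul t x y := bracketr_smul_right (d := d) r t x y

theorem lie_def {d : ℕ} (r : ℂ) (x y : calL d) :
    ⁅toLr r x, toLr r y⁆ = toLr r (bracketr r x y) := rfl

/-- The element `v^{ij}(m,n)` of `𝓛_r`. -/
def vL {d : ℕ} (r : ℂ) (i j : Fin d) (m n : ℤ) : LieLr d r :=
  toLr r ⟨vv i j m n, vv_mem_calL i j m n⟩

/-- The Lie subalgebra `𝓛_r⁺ = (Span 𝓑₊) ⊕ ℂ` of `𝓛_r`. -/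
def LrPlus (d : ℕ) (r : ℂ) : LieSubalgebra ℂ (LieLr d r) where
  toSubmodule := ((calLplus d).comap (calL d).subtype).comap (toLr r).symm.toLinearMap
  lie_mem' := by
    intro x y hx hy
    change ((bracketr r ((toLr r).symm x) ((toLr r).symm y) : calL d) : HeisU d) ∈ calLplus d
    rw [bracketr_eq]
    exact add_mem (comm_mem_calLplus hx hy) (Submodule.smul_mem _ _
      (Submodule.mem_sup_right (Submodule.mem_span_singleton_self 1)))

theorem fock_plus {d : ℕ} {x : HeisU d} (hx : x ∈ calLplus d) :
    fock d x 1 = vev d x • (1 : MvPolynomial (Fin d × ℤ) ℂ) := by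
  rw [calLplus, ← Submodule.span_union] at hx
  induction hx using Submodule.span_induction with
  | mem x h =>
    rcases h with h | rfl
    · simp [vev, fock_Bplus h]
    · simp [vev]
  | zero => simp
  | add x y _ _ hx hy => simp [hx, hy, add_smul]
  | smul a x _ hx => simp [hx, mul_smul]

/-- The character of `𝓛_r⁺` giving the one-dimensional module `ℂ𝟏`: it is `0` on `𝓑₊`
and `s ↦ s` on `ℂ`. -/
def vacChar (d : ℕ) (r : ℂ) : LrPlus d r →ₗ⁅ℂ⁆ ℂ where
  toLinearMap := proj2 d ∘ₗ (toLr r).symm.toLinearMap ∘ₗ (LrPlus d r).toSubmodule.subtype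
  map_lie' := by
    rintro ⟨x, hx⟩ ⟨y, hy⟩
    have hx' : (((toLr r).symm x : calL d) : HeisU d) ∈ calLplus d := hx
    have hy' : (((toLr r).symm y : calL d) : HeisU d) ∈ calLplus d := hy
    rw [LieRing.of_associative_ring_bracket, mul_comm, sub_self]
    change proj2 d (bracketr r ((toLr r).symm x) ((toLr r).symm y)) = 0
    have h0 : proj2 d (commL ((toLr r).symm x) ((toLr r).symm y)) = 0 := by
      rw [proj2_eq_vev]
      have hv : fock d (commL ((toLr r).symm x) ((toLr r).symm y)) 1 = 0 := by
        rw [commL, map_sub, map_mul, map_mul, LinearMap.sub_apply, Module.End.mul_apply,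
          Module.End.mul_apply, fock_plus hx', fock_plus hy', map_smul, map_smul, fock_plus hx',
          fock_plus hy', smul_comm, sub_self]
      rw [vev_apply, hv, map_zero]
    rw [bracketr_eq, map_add, map_smul, h0]
    simp

/-! ### The induced module `M_r` -/

/-- The action of `U(𝓛_r⁺)` on `ℂ𝟏`. -/
def vacAlg (d : ℕ) (r : ℂ) : UniversalEnvelopingAlgebra ℂ (LrPlus d r) →ₐ[ℂ] ℂ :=
  UniversalEnvelopingAlgebra.lift ℂ (vacChar d r)

/-- The algebra morphism `U(𝔨) → U(𝔤)` induced by the inclusion of a Lie subalgebra `𝔨` of `𝔤`. -/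
def envIncl {L : Type*} [LieRing L] [LieAlgebra ℂ L] (K : LieSubalgebra ℂ L) :
    UniversalEnvelopingAlgebra ℂ K →ₐ[ℂ] UniversalEnvelopingAlgebra ℂ L :=
  UniversalEnvelopingAlgebra.lift ℂ ((UniversalEnvelopingAlgebra.ι ℂ).comp K.incl)

theorem envIncl_ι {L : Type*} [LieRing L] [LieAlgebra ℂ L] (K : LieSubalgebra ℂ L) (x : K) :
    envIncl K (UniversalEnvelopingAlgebra.ι ℂ x) = UniversalEnvelopingAlgebra.ι ℂ (x : L) := by
  rw [envIncl, UniversalEnvelopingAlgebra.lift_ι_apply]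
  rfl

open scoped TensorProduct in
/-- The `U(𝓛_r)`-submodule of `U(𝓛_r) ⊗_ℂ ℂ𝟏` generated by the elements `uu' ⊗ z - u ⊗ u'z`
with `u ∈ U(𝓛_r)` and `u' ∈ U(𝓛_r⁺)`. -/
def balanced (d : ℕ) (r : ℂ) : Submodule (UniversalEnvelopingAlgebra ℂ (LieLr d r))
    (UniversalEnvelopingAlgebra ℂ (LieLr d r) ⊗[ℂ] ℂ) :=
  Submodule.span _ {t | ∃ (u : UniversalEnvelopingAlgebra ℂ (LieLr d r))
    (u' : UniversalEnvelopingAlgebra ℂ (LrPlus d r)) (z : ℂ),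
    t = (u * envIncl (LrPlus d r) u') ⊗ₜ[ℂ] z - u ⊗ₜ[ℂ] (vacAlg d r u' * z)}

open scoped TensorProduct in
/-- The induced module `M_r = U(𝓛_r) ⊗_{U(𝓛_r⁺)} ℂ𝟏`. -/
def Mr (d : ℕ) (r : ℂ) : Type :=
  (UniversalEnvelopingAlgebra ℂ (LieLr d r) ⊗[ℂ] ℂ) ⧸ balanced d r

instance (d : ℕ) (r : ℂ) : AddCommGroup (Mr d r) :=
  inferInstanceAs (AddCommGroup (_ ⧸ balanced d r))

instance (d : ℕ) (r : ℂ) : Module (UniversalEnvelopingAlgebra ℂ (LieLr d r)) (Mr d r) :=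
  inferInstanceAs (Module _ (_ ⧸ balanced d r))

instance (d : ℕ) (r : ℂ) : Module ℂ (Mr d r) :=
  inferInstanceAs (Module ℂ (_ ⧸ balanced d r))

instance (d : ℕ) (r : ℂ) :
    IsScalarTower ℂ (UniversalEnvelopingAlgebra ℂ (LieLr d r)) (Mr d r) :=
  inferInstanceAs (IsScalarTower ℂ _ (_ ⧸ balanced d r))

open scoped TensorProduct in
/-- The vector `𝟏` of `M_r`. -/
def vac (d : ℕ) (r : ℂ) : Mr d r :=
  Submodule.Quotient.mk ((1 : UniversalEnvelopingAlgebra ℂ (LieLr d r)) ⊗ₜ[ℂ] (1 : ℂ))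

/-- `M_r` as an `𝓛_r`-module. -/
instance (d : ℕ) (r : ℂ) : LieRingModule (LieLr d r) (Mr d r) where
  bracket x m := UniversalEnvelopingAlgebra.ι ℂ x • m
  add_lie x y m := by
    change UniversalEnvelopingAlgebra.ι ℂ (x + y) • m = _ • m + _ • m
    rw [map_add, add_smul]
  lie_add x m n := smul_add _ _ _
  leibniz_lie x y m := by
    change _ • _ • m = UniversalEnvelopingAlgebra.ι ℂ ⁅x, y⁆ • m + _ • _ • m
    rw [LieHom.map_lie, LieRing.of_associative_ring_bracket, sub_smul, mul_smul, mul_smul]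
    abel

theorem lie_Mr {d : ℕ} {r : ℂ} (x : LieLr d r) (m : Mr d r) :
    ⁅x, m⁆ = UniversalEnvelopingAlgebra.ι ℂ x • m := rfl

instance (d : ℕ) (r : ℂ) : LieModule ℂ (LieLr d r) (Mr d r) where
  smul_lie t x m := by rw [lie_Mr, lie_Mr, map_smul, smul_assoc]
  lie_smul t x m := by rw [lie_Mr, lie_Mr, smul_comm]

/-! ### `𝓛_r^{(1)}` and `M_r^{(1)}`

For later convenience the upper index `1` is replaced by an arbitrary index `i : Fin d`. -/

/-- The Lie subalgebra of `𝓛_r` generated by the `v^{ii}(m,n)` with `m ≤ n`. -/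
def LrOne (d : ℕ) (r : ℂ) (i : Fin d) : LieSubalgebra ℂ (LieLr d r) :=
  LieSubalgebra.lieSpan ℂ (LieLr d r) {x | ∃ m n : ℤ, m ≤ n ∧ x = vL r i i m n}

/-- The `𝓛_r^{(i)}`-submodule `U(𝓛_r^{(i)})𝟏` of `M_r`. -/
def MrOne (d : ℕ) (r : ℂ) (i : Fin d) : LieSubmodule ℂ (LrOne d r i) (Mr d r) where
  carrier := {w | ∃ u : UniversalEnvelopingAlgebra ℂ (LrOne d r i),
    w = envIncl (LrOne d r i) u • vac d r}
  zero_mem' := ⟨0, by simp⟩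
  add_mem' := by
    rintro _ _ ⟨u, rfl⟩ ⟨u', rfl⟩
    exact ⟨u + u', by rw [map_add, add_smul]⟩
  smul_mem' := by
    rintro t _ ⟨u, rfl⟩
    exact ⟨t • u, by rw [map_smul, smul_assoc]⟩
  lie_mem := by
    rintro x _ ⟨u, rfl⟩
    refine ⟨UniversalEnvelopingAlgebra.ι ℂ x * u, ?_⟩
    rw [map_mul, mul_smul, envIncl_ι, LieSubalgebra.coe_bracket_of_module, lie_Mr]

end AshiharaMiyamoto

end

noncomputable section

namespace AshiharaMiyamoto

attribute [local instance 100] LieRing.ofAssociativeRing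

open MvPolynomial

/-! ### A model of the induced module by first-order differential operators -/

/-! The induced module $M_r$ is embedded in a model where lowering operators are plain derivatives.
The model `Pol d` consists of polynomials in the entries $X_{ab}$ of a symmetric matrix indexed by
the creation modes. A product of two Heisenberg generators acts as a Riccati vector field plus
multiplication by $r$ times a contraction (`quadOp`). The contraction behaves like the two-point
function of a Gaussian state with covariance $X$, and the vector field like the connected four-point
function of Wick's theorem. With one scalar correction this represents $\mathcal L_r$ (`modelRep`),
and the constant $1$ satisfies the vacuum conditions. Hence there is a homomorphism `toModel` from
$M_r$ with $\mathbf 1\mapsto 1$.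

A product of two positive modes acts as a nonzero multiple of $\partial/\partial X_{ab}$. The image
of $M_r^{(1)}$ involves only variables of the first family, and the corresponding derivatives come
from $\mathcal L_r^{(1)}$. So once `toModel` is injective, any nonzero vector of a submodule of
$M_r^{(1)}$ can be differentiated down to a nonzero multiple of $\mathbf 1$, which generates.

Injectivity is where $r\notin\mathbb Z$ enters. Creation operators commute and their words on
$\mathbf 1$ span $M_r$ (`fromPol_surjective`), so there is a composite `Pol d` → $M_r$ → `Pol d`. It
preserves the multiset of indices of a monomial, and these weight spaces are finite dimensional. It
therefore suffices that the composite is onto, that is, that $1$ generates the model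
(`eq_top_of_one_mem`). On a weight space with distinct indices, creation realises $(r-1)+J$ with $J$
a Jucys–Murphy element. Its eigenvalues are integers (`jucysMurphy_eigenvalue_int`), so $(r-1)+J$ is
invertible. Repeated indices are reached by replacing fresh indices with prescribed ones. -/

/-- The index `(i, -(k + 1))` of a creation operator. -/
def cre {d : ℕ} (a : Fin d × ℕ) : Fin d × ℤ := (a.1, -((a.2 : ℤ) + 1))

/-- The index `(i, k + 1)` of the annihilation operator dual to `cre a`. -/
def ann {d : ℕ} (a : Fin d × ℕ) : Fin d × ℤ := (a.1, (a.2 : ℤ) + 1)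

/-- The left inverse of `cre`. -/
def creInv {d : ℕ} (p : Fin d × ℤ) : Fin d × ℕ := (p.1, (-p.2 - 1).toNat)

theorem cre_neg {d : ℕ} (a : Fin d × ℕ) : (cre a).2 < 0 := by
  simp only [cre]
  omega

theorem creInv_cre {d : ℕ} (a : Fin d × ℕ) : creInv (cre a) = a := by
  simp [creInv, cre]

theorem cre_creInv {d : ℕ} {p : Fin d × ℤ} (hp : p.2 < 0) : cre (creInv p) = p := by
  refine Prod.ext rfl ?_
  simp only [creInv, cre]
  omega

theorem eq_cre_or_nonneg {d : ℕ} (p : Fin d × ℤ) : (∃ a, p = cre a) ∨ 0 ≤ p.2 := by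
  rcases lt_or_ge p.2 0 with h | h
  · exact Or.inl ⟨creInv p, (cre_creInv h).symm⟩
  · exact Or.inr h

/-- `heisCoeff` on pairs of indices. -/
def pairing {d : ℕ} (p q : Fin d × ℤ) : ℂ := heisCoeff p.1 q.1 p.2 q.2

theorem pairing_skew {d : ℕ} (p q : Fin d × ℤ) : pairing p q = -pairing q p := by
  rw [pairing, pairing, ← heisForm_single, ← heisForm_single, heisForm_skew]

theorem pairing_cre_cre {d : ℕ} (a b : Fin d × ℕ) : pairing (cre a) (cre b) = 0 := by
  have := cre_neg a
  have := cre_neg b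
  exact if_neg (by omega)

theorem pairing_of_nonneg {d : ℕ} {p q : Fin d × ℤ} (hp : 0 ≤ p.2) (hq : 0 ≤ q.2) :
    pairing p q = 0 := by
  unfold pairing heisCoeff
  split_ifs with h
  · have : p.2 = 0 := by omega
    simp [this]
  · rfl

/-- Polynomials on the space of symmetric matrices. -/
abbrev Pol (d : ℕ) : Type := MvPolynomial (Sym2 (Fin d × ℕ)) ℂ

/-- The contraction of two Heisenberg generators along the symmetric matrix of variables. -/
def contr {d : ℕ} (p q : Fin d × ℤ) : Pol d :=
  if q.2 < 0 then
    if p.2 < 0 then X s(creInv p, creInv q) else C (pairing p q)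
  else 0

theorem contr_cre_cre {d : ℕ} (a b : Fin d × ℕ) : contr (cre a) (cre b) = X s(a, b) := by
  simp only [contr, cre_neg, if_true, creInv_cre]

theorem contr_right_nonneg {d : ℕ} {p q : Fin d × ℤ} (hq : 0 ≤ q.2) : contr p q = 0 :=
  if_neg (not_lt.mpr hq)

theorem contr_left_nonneg {d : ℕ} {p : Fin d × ℤ} (hp : 0 ≤ p.2) (b : Fin d × ℕ) :
    contr p (cre b) = C (pairing p (cre b)) := by
  simp only [contr, cre_neg, if_true, not_lt.mpr hp, if_false]

/-- For two creation modes the symmetry of $X$ cancels the difference; in a mixed pair only one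
order contributes. The later operator identities use this to rewrite every structure constant as a
difference of contractions, leaving an identity in a commutative ring. -/
theorem contr_sub_contr {d : ℕ} (p q : Fin d × ℤ) :
    contr p q - contr q p = C (pairing p q) := by
  rcases eq_cre_or_nonneg p with ⟨a, rfl⟩ | hp <;> rcases eq_cre_or_nonneg q with ⟨b, rfl⟩ | hq
  · rw [contr_cre_cre, contr_cre_cre, Sym2.eq_swap, sub_self, pairing_cre_cre, C_0]
  · rw [contr_right_nonneg hq, contr_left_nonneg hq, pairing_skew q, C_neg]
    ring
  · rw [contr_right_nonneg hp, contr_left_nonneg hp, sub_zero]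
  · rw [contr_right_nonneg hp, contr_right_nonneg hq, pairing_of_nonneg hp hq, C_0, sub_zero]

/-- The vector field on symmetric matrices given by a product of two Heisenberg generators. -/
def riccati {d : ℕ} (p q : Fin d × ℤ) : Derivation ℂ (Pol d) (Pol d) :=
  mkDerivation ℂ (Sym2.lift ⟨fun a b =>
    contr p (cre a) * contr q (cre b) + contr q (cre a) * contr p (cre b), fun a b => by ring⟩)

theorem riccati_X {d : ℕ} (p q : Fin d × ℤ) (a b : Fin d × ℕ) :
    riccati p q (X s(a, b)) =
      contr p (cre a) * contr q (cre b) + contr q (cre a) * contr p (cre b) := by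
  rw [riccati, mkDerivation_X, Sym2.lift_mk]

theorem riccati_symm {d : ℕ} (p q : Fin d × ℤ) : riccati p q = riccati q p := by
  apply derivation_ext
  rintro ⟨a, b⟩
  change riccati p q (X s(a, b)) = riccati q p (X s(a, b))
  rw [riccati_X, riccati_X]
  ring

/-- Wick's rule, extended from the variables to all contractions. The argument order matters: `p`
stands on the right, so both products vanish when `p` is nonnegative, as they must because `contr p
q` is then constant. -/
theorem riccati_contr {d : ℕ} (u v p q : Fin d × ℤ) :
    riccati u v (contr p q) = contr u q * contr v p + contr v q * contr u p := by
  rcases eq_cre_or_nonneg q with ⟨b, rfl⟩ | hq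
  · rcases eq_cre_or_nonneg p with ⟨a, rfl⟩ | hp
    · rw [contr_cre_cre, riccati_X]
      ring
    · rw [contr_left_nonneg hp, contr_right_nonneg hp, contr_right_nonneg hp, derivation_C]
      ring
  · rw [contr_right_nonneg hq, contr_right_nonneg hq, contr_right_nonneg hq, map_zero]
    ring

/-- The first-order operator by which a product of two Heisenberg generators acts in the model. -/
def quadOp {d : ℕ} (r : ℂ) (p q : Fin d × ℤ) : Module.End ℂ (Pol d) :=
  (riccati p q).toLinearMap + LinearMap.mulLeft ℂ (C r * contr p q)

theorem quadOp_apply {d : ℕ} (r : ℂ) (p q : Fin d × ℤ) (f : Pol d) :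
    quadOp r p q f = riccati p q f + C r * contr p q * f := rfl

theorem riccati_comm {d : ℕ} (u v p q : Fin d × ℤ) :
    ⁅riccati u v, riccati p q⁆ = pairing v p • riccati u q + pairing u p • riccati v q +
      pairing v q • riccati p u + pairing u q • riccati p v := by
  apply derivation_ext
  rintro ⟨a, b⟩
  change ⁅riccati u v, riccati p q⁆ (X s(a, b)) = (pairing v p • riccati u q +
    pairing u p • riccati v q + pairing v q • riccati p u + pairing u q • riccati p v) (X s(a, b))
  simp only [Derivation.commutator_apply, Derivation.add_apply, Derivation.smul_apply, riccati_X,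
    map_add, Derivation.leibniz, riccati_contr, smul_eq_mul, MvPolynomial.smul_eq_C_mul,
    ← contr_sub_contr]
  ring

/-- The vector fields close by `riccati_comm`, and the contraction is a 1-cocycle for them, so any
multiple $r$ of it may be added. The structure constants are those of `vv_comm`. -/
theorem quadOp_comm {d : ℕ} (r : ℂ) (u v p q : Fin d × ℤ) :
    quadOp r u v * quadOp r p q - quadOp r p q * quadOp r u v =
      pairing v p • quadOp r u q + pairing u p • quadOp r v q +
        pairing v q • quadOp r p u + pairing u q • quadOp r p v := by
  refine LinearMap.ext fun f => ?_
  have h := Derivation.congr_fun (riccati_comm u v p q) f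
  simp only [Derivation.commutator_apply, Derivation.add_apply, Derivation.smul_apply,
    MvPolynomial.smul_eq_C_mul] at h
  simp only [LinearMap.sub_apply, LinearMap.add_apply, LinearMap.smul_apply,
    Module.End.mul_apply, quadOp_apply, map_add, Derivation.leibniz, riccati_contr, smul_eq_mul,
    MvPolynomial.smul_eq_C_mul, derivation_C]
  have h' : riccati u v (riccati p q f) = riccati p q (riccati u v f) +
      (C (pairing v p) * riccati u q f + C (pairing u p) * riccati v q f +
        C (pairing v q) * riccati p u f + C (pairing u q) * riccati p v f) := by
    rw [← h]
    ring
  rw [h']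
  simp only [← contr_sub_contr]
  ring

/-- In $\mathcal L$ the same difference is the pairing times $1$, so a linear map sending products
to `quadOp` must send $1$ to $r$. -/
theorem quadOp_sub_swap {d : ℕ} (r : ℂ) (p q : Fin d × ℤ) :
    quadOp r p q - quadOp r q p = (r * pairing p q) • 1 := by
  refine LinearMap.ext fun f => ?_
  rw [LinearMap.sub_apply, quadOp_apply, quadOp_apply, riccati_symm q p]
  have : C (σ := Sym2 (Fin d × ℕ)) (r * pairing p q) = C r * (contr p q - contr q p) := by
    rw [contr_sub_contr, C_mul]
  rw [LinearMap.smul_apply, MvPolynomial.smul_eq_C_mul, this, Module.End.one_apply]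
  ring

/-! ### Normally ordered symbols -/

/-- The commuting variable attached to a Heisenberg generator. -/
def heisVar (d : ℕ) : Heis d →ₗ[ℂ] MvPolynomial (Fin d × ℤ) ℂ :=
  (Finsupp.linearCombination ℂ X : ((Fin d × ℤ) →₀ ℂ) →ₗ[ℂ] MvPolynomial (Fin d × ℤ) ℂ) ∘ₗ
    (LinearMap.fst ℂ ((Fin d × ℤ) →₀ ℂ) ℂ : Heis d →ₗ[ℂ] ((Fin d × ℤ) →₀ ℂ))

theorem heisVar_lie {d : ℕ} (x y : Heis d) : heisVar d ⁅x, y⁆ = 0 :=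
  (Finsupp.linearCombination ℂ (X : _ → MvPolynomial (Fin d × ℤ) ℂ)).map_zero

theorem heisVar_heisC (d : ℕ) : heisVar d (heisC d) = 0 :=
  (Finsupp.linearCombination ℂ (X : _ → MvPolynomial (Fin d × ℤ) ℂ)).map_zero

theorem heisVar_heisV {d : ℕ} (i : Fin d) (m : ℤ) : heisVar d (heisV i m) = X (i, m) := by
  change Finsupp.linearCombination ℂ X (Finsupp.single (i, m) (1 : ℂ)) = _
  rw [Finsupp.linearCombination_single, one_smul]

/-- The class of an element of the Heisenberg algebra in `U(ĥ)/⟨c - 1⟩`. -/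
def heisMk (d : ℕ) : Heis d →ₗ⁅ℂ⁆ HeisU d :=
  (RingQuot.mkAlgHom ℂ (CentralRel d)).toLieHom.comp (UniversalEnvelopingAlgebra.ι ℂ)

open scoped TensorProduct in
/-- The translation `v ↦ v ⊗ 1 + 1 ⊗ w` of the Heisenberg generators by commuting variables. -/
def shiftLie (d : ℕ) : Heis d →ₗ⁅ℂ⁆ HeisU d ⊗[ℂ] MvPolynomial (Fin d × ℤ) ℂ where
  toLinearMap :=
    (Algebra.TensorProduct.includeLeft (R := ℂ) (S := ℂ) (A := HeisU d)
      (B := MvPolynomial (Fin d × ℤ) ℂ)).toLinearMap ∘ₗ (heisMk d).toLinearMap +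
    (Algebra.TensorProduct.includeRight (R := ℂ) (A := HeisU d)
      (B := MvPolynomial (Fin d × ℤ) ℂ)).toLinearMap ∘ₗ heisVar d
  map_lie' := by
    intro x y
    change heisMk d ⁅x, y⁆ ⊗ₜ 1 + 1 ⊗ₜ[ℂ] heisVar d ⁅x, y⁆ =
      ⁅heisMk d x ⊗ₜ 1 + 1 ⊗ₜ[ℂ] heisVar d x, heisMk d y ⊗ₜ 1 + 1 ⊗ₜ[ℂ] heisVar d y⁆
    rw [heisVar_lie, TensorProduct.tmul_zero, add_zero, LieHom.map_lie,
      LieRing.of_associative_ring_bracket, LieRing.of_associative_ring_bracket]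
    simp only [mul_add, add_mul, Algebra.TensorProduct.tmul_mul_tmul, mul_one, one_mul,
      TensorProduct.sub_tmul]
    rw [mul_comm (heisVar d y)]
    abel

open scoped TensorProduct in
/-- The translation homomorphism on `U(ĥ)/⟨c - 1⟩`. -/
def shift (d : ℕ) : HeisU d →ₐ[ℂ] HeisU d ⊗[ℂ] MvPolynomial (Fin d × ℤ) ℂ :=
  RingQuot.liftAlgHom ℂ ⟨UniversalEnvelopingAlgebra.lift ℂ (shiftLie d), by
    rintro _ _ ⟨⟩
    rw [UniversalEnvelopingAlgebra.lift_ι_apply, map_one]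
    change RingQuot.mkAlgHom ℂ (CentralRel d) (UniversalEnvelopingAlgebra.ι ℂ (heisC d)) ⊗ₜ 1 +
      1 ⊗ₜ[ℂ] heisVar d (heisC d) = 1
    rw [RingQuot.mkAlgHom_rel ℂ CentralRel.c_eq_one, map_one, heisVar_heisC,
      TensorProduct.tmul_zero, add_zero]
    rfl⟩

open scoped TensorProduct in
theorem shift_gen {d : ℕ} (i : Fin d) (m : ℤ) :
    shift d (gen i m) = gen i m ⊗ₜ[ℂ] 1 + 1 ⊗ₜ[ℂ] X (i, m) := by
  rw [shift, gen, RingQuot.liftAlgHom_mkAlgHom_apply, UniversalEnvelopingAlgebra.lift_ι_apply,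
    ← heisVar_heisV]
  rfl

/-- The normally ordered symbol of an element of `U(ĥ)/⟨c - 1⟩`. -/
def symbol (d : ℕ) : HeisU d →ₗ[ℂ] MvPolynomial (Fin d × ℤ) ℂ :=
  (TensorProduct.lid ℂ (MvPolynomial (Fin d × ℤ) ℂ)).toLinearMap ∘ₗ
    (vev d).rTensor (MvPolynomial (Fin d × ℤ) ℂ) ∘ₗ (shift d).toLinearMap

theorem symbol_one (d : ℕ) : symbol d 1 = 1 := by
  simp [symbol, Algebra.TensorProduct.one_def, vev_one]

theorem vev_gen {d : ℕ} (i : Fin d) (m : ℤ) : vev d (gen i m) = 0 := by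
  rw [vev_apply, fock_gen, fockOp]
  split_ifs <;> simp

/-- `vv` on pairs of indices. -/
def vp {d : ℕ} (p q : Fin d × ℤ) : HeisU d := vv p.1 q.1 p.2 q.2

theorem vp_sub_swap {d : ℕ} (p q : Fin d × ℤ) : vp p q - vp q p = pairing p q • 1 := by
  rw [vp, vp, vv, vv, gen_mul_comm, add_sub_cancel_left, pairing]

/-- The translation expands the product, and the vacuum expectation kills the terms linear in a
generator. Through this symbol a linear map on the whole quotient algebra can be prescribed on a
monomial basis, so linear independence of $\mathcal B$ is never needed. -/
theorem symbol_vp {d : ℕ} (p q : Fin d × ℤ) :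
    symbol d (vp p q) = X p * X q + C (vev d (vp p q)) := by
  simp [symbol, vp, vv, shift_gen, mul_add, add_mul, vev_gen, vev_one, smul_eq_C_mul]
  ring

theorem vev_vp_right_nonneg {d : ℕ} (p : Fin d × ℤ) {q : Fin d × ℤ} (hq : 0 ≤ q.2) :
    vev d (vp p q) = 0 := by
  rw [vev_apply, vp, vv, map_mul, fock_gen, fock_gen, Module.End.mul_apply]
  simp [fockOp, not_lt.mpr hq]

theorem vev_vp_left_neg {d : ℕ} {p : Fin d × ℤ} (hp : p.2 < 0) (q : Fin d × ℤ) :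
    vev d (vp p q) = 0 := by
  rw [vev_apply, vp, vv, map_mul, fock_gen, fock_gen, Module.End.mul_apply]
  simp [fockOp, hp]

/-- Splits a contraction into its variable part, present only for two creation modes, and its vacuum
expectation. The vacuum condition in the model rests on this. -/
theorem contr_eq {d : ℕ} (p q : Fin d × ℤ) :
    contr p q = (if p.2 < 0 ∧ q.2 < 0 then X s(creInv p, creInv q) else 0) +
      C (vev d (vp p q)) := by
  unfold contr
  split_ifs with hq hp h2 h2 h2
  · rw [vev_vp_left_neg hp, C_0, add_zero]
  · exact absurd ⟨hp, hq⟩ h2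
  · exact absurd h2.1 hp
  · rw [zero_add]
    congr 1
    have h := congrArg (vev d) (vp_sub_swap p q)
    rw [map_sub, vev_vp_left_neg hq, sub_zero, map_smul, vev_one] at h
    simpa using h.symm
  · exact absurd h2.2 hq
  · rw [vev_vp_right_nonneg p (not_lt.mp hq), C_0, add_zero]

/-- The operator attached to a normally ordered product. -/
def normalOp {d : ℕ} (r : ℂ) : Sym2 (Fin d × ℤ) → Module.End ℂ (Pol d) :=
  Sym2.lift ⟨fun p q => quadOp r p q - (r * vev d (vp p q)) • 1, fun p q => by
    -- Exchanging `p` and `q` changes `quadOp` and $r$ times the vacuum expectation by the same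
    -- scalar, so the difference descends to unordered pairs.
    have h := quadOp_sub_swap r p q
    have h2 := congrArg (vev d) (vp_sub_swap p q)
    rw [map_sub, map_smul, vev_one, smul_eq_mul, mul_one, sub_eq_iff_eq_add] at h2
    rw [sub_eq_iff_eq_add] at h
    change quadOp r p q - (r * vev d (vp p q)) • 1 = quadOp r q p - (r * vev d (vp q p)) • 1
    rw [h, h2]
    module⟩

/-- The operator attached to a monomial in the symbols of the Heisenberg generators. -/
def monoOp {d : ℕ} (r : ℂ) (e : (Fin d × ℤ) →₀ ℕ) : Module.End ℂ (Pol d) :=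
  if h : (Finsupp.toMultiset e).card = 2 then
    normalOp r ((Sym2.equivSym _).symm ⟨Finsupp.toMultiset e, h⟩)
  -- The value $r$ is forced by `quadOp_sub_swap`. The value $0$ is a default: symbols of elements
  -- of $\mathcal L$ have only degrees $0$ and $2$.
  else if e = 0 then r • 1 else 0

/-- The operator attached to an element of `U(ĥ)/⟨c - 1⟩`; it represents commutators on `𝓛`. -/
def modelOp (d : ℕ) (r : ℂ) : HeisU d →ₗ[ℂ] Module.End ℂ (Pol d) :=
  (basisMonomials (Fin d × ℤ) ℂ).constr ℂ (monoOp r) ∘ₗ symbol d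

theorem constr_monomial {d : ℕ} (r : ℂ) (e : (Fin d × ℤ) →₀ ℕ) :
    (basisMonomials (Fin d × ℤ) ℂ).constr ℂ (monoOp (d := d) r) (monomial e 1) = monoOp r e := by
  have : (monomial e (1 : ℂ)) = basisMonomials (Fin d × ℤ) ℂ e := by rw [coe_basisMonomials]
  rw [this, Module.Basis.constr_basis]

theorem constr_one {d : ℕ} (r : ℂ) :
    (basisMonomials (Fin d × ℤ) ℂ).constr ℂ (monoOp (d := d) r) 1 = r • 1 := by
  rw [show (1 : MvPolynomial (Fin d × ℤ) ℂ) = monomial 0 1 from rfl, constr_monomial, monoOp]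
  simp

theorem modelOp_one (d : ℕ) (r : ℂ) : modelOp d r 1 = r • 1 := by
  rw [modelOp, LinearMap.comp_apply, symbol_one, constr_one]

theorem monoOp_pair {d : ℕ} (r : ℂ) (p q : Fin d × ℤ) :
    monoOp r (Finsupp.single p 1 + Finsupp.single q 1) = normalOp r s(p, q) := by
  have hm : Finsupp.toMultiset (Finsupp.single p 1 + Finsupp.single q 1) = {p, q} := by
    simp [Finsupp.toMultiset_single]
  have hc : (Finsupp.toMultiset (Finsupp.single p 1 + Finsupp.single q 1)).card = 2 := by
    rw [hm, Multiset.card_pair]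
  rw [monoOp, dif_pos hc]
  congr 1
  exact (Equiv.symm_apply_eq (Sym2.equivSym _)).mpr (Subtype.ext hm)

theorem modelOp_vp {d : ℕ} (r : ℂ) (p q : Fin d × ℤ) :
    modelOp d r (vp p q) = quadOp r p q := by
  have h : (X p * X q : MvPolynomial (Fin d × ℤ) ℂ) =
      monomial (Finsupp.single p 1 + Finsupp.single q 1) 1 := by
    rw [X, X, monomial_mul, one_mul]
  rw [modelOp, LinearMap.comp_apply, symbol_vp, map_add, h, constr_monomial, monoOp_pair,
    ← mul_one (C _), ← smul_eq_C_mul, map_smul, constr_one, normalOp, Sym2.lift_mk]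
  module

/-! ### The model operators as a representation of $\mathcal L_r$ -/

theorem span_vp_eq (d : ℕ) : calL d = Submodule.span ℂ
    (Set.range (fun x : (Fin d × ℤ) × (Fin d × ℤ) => vp x.1 x.2) ∪ {1}) := by
  apply le_antisymm
  · rw [calL, ← Submodule.span_union]
    apply Submodule.span_mono
    apply Set.union_subset_union_left
    rintro _ (⟨i, m, n, -, rfl⟩ | ⟨i, j, m, n, -, rfl⟩)
    · exact ⟨((i, m), (i, n)), rfl⟩
    · exact ⟨((i, m), (j, n)), rfl⟩
  · rw [Submodule.span_le]
    rintro _ (⟨x, rfl⟩ | rfl)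
    · exact vv_mem_calL _ _ _ _
    · exact one_mem_calL d

theorem vp_comm {d : ℕ} (u v p q : Fin d × ℤ) :
    vp u v * vp p q - vp p q * vp u v = pairing v p • vp u q + pairing u p • vp v q +
        pairing v q • vp p u + pairing u q • vp p v :=
  vv_comm _ _ _ _ _ _ _ _

theorem modelOp_comm {d : ℕ} (r : ℂ) {x y : HeisU d} (hx : x ∈ calL d) (hy : y ∈ calL d) :
    modelOp d r (x * y - y * x) = modelOp d r x * modelOp d r y - modelOp d r y * modelOp d r x := by
  rw [span_vp_eq] at hx hy
  induction hx, hy using Submodule.span_induction₂ with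
  | mem_mem x y hx hy =>
    rcases hx with ⟨x, rfl⟩ | rfl
    · rcases hy with ⟨y, rfl⟩ | rfl
      · simp only [vp_comm, modelOp_vp, quadOp_comm, map_add, map_smul]
      · simp [modelOp_one]
    · simp [modelOp_one]
  | zero_left y hy => simp
  | zero_right x hx => simp
  | add_left x y z _ _ _ h1 h2 =>
    have : (x + y) * z - z * (x + y) = (x * z - z * x) + (y * z - z * y) := by noncomm_ring
    rw [this, map_add, h1, h2, map_add]
    noncomm_ring
  | add_right x y z _ _ _ h1 h2 =>
    have : x * (y + z) - (y + z) * x = (x * y - y * x) + (x * z - z * x) := by noncomm_ring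
    rw [this, map_add, h1, h2, map_add]
    noncomm_ring
  | smul_left a x y _ _ h =>
    rw [smul_mul_assoc, mul_smul_comm, ← smul_sub, map_smul, h, map_smul, smul_mul_assoc,
      mul_smul_comm, smul_sub]
  | smul_right a x y _ _ h =>
    rw [smul_mul_assoc, mul_smul_comm, ← smul_sub, map_smul, h, map_smul, smul_mul_assoc,
      mul_smul_comm, smul_sub]

/-- The representation of `𝓛_r` on `Pol d`. -/
def modelRep (d : ℕ) (r : ℂ) : LieLr d r →ₗ⁅ℂ⁆ Module.End ℂ (Pol d) where
  toLinearMap := (modelOp d r ∘ₗ (calL d).subtype +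
    -- `modelOp` sends $1$ to $r$; adding $(1-r)\pi_2$ makes $1$ act as the identity. This matches
    -- the rescaling of the central part by $r$ in $[\cdot,\cdot]_r$.
    (LinearMap.toSpanSingleton ℂ _ (1 : Module.End ℂ (Pol d))) ∘ₗ ((1 - r) • proj2 d)) ∘ₗ
      (toLr r).symm.toLinearMap
  map_lie' := by
    intro x y
    obtain ⟨x, rfl⟩ := (toLr r).surjective x
    obtain ⟨y, rfl⟩ := (toLr r).surjective y
    rw [lie_def]
    change modelOp d r (bracketr r x y : calL d) + ((1 - r) * proj2 d (bracketr r x y)) • 1 =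
      ⁅modelOp d r x + ((1 - r) * proj2 d x) • 1, modelOp d r y + ((1 - r) * proj2 d y) • 1⁆
    have h : modelOp d r (bracketr r x y : calL d) =
        modelOp d r ((x : HeisU d) * y - y * x) + ((r - 1) * proj2 d (commL x y) * r) • 1 := by
      rw [bracketr_eq]
      change modelOp d r (((x : HeisU d) * y - y * x) + ((r - 1) * proj2 d (commL x y)) • 1) = _
      rw [map_add, map_smul, modelOp_one, smul_smul]
    rw [h, modelOp_comm r x.2 y.2, bracketr_eq, map_add, map_smul, proj2_one,
      LieRing.of_associative_ring_bracket]
    simp only [add_mul, mul_add, smul_mul_assoc, mul_smul_comm, one_mul, mul_one, smul_eq_mul]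
    module

theorem modelRep_apply {d : ℕ} (r : ℂ) (x : calL d) :
    modelRep d r (toLr r x) = modelOp d r x + ((1 - r) * proj2 d x) • 1 := rfl

/-- `vL` on pairs of indices. -/
def vpL {d : ℕ} (r : ℂ) (p q : Fin d × ℤ) : LieLr d r := vL r p.1 q.1 p.2 q.2

theorem modelRep_vpL {d : ℕ} (r : ℂ) (p q : Fin d × ℤ) :
    modelRep d r (vpL r p q) = quadOp r p q + ((1 - r) * vev d (vp p q)) • 1 := by
  rw [vpL, vL, modelRep_apply, proj2_eq_vev]
  change modelOp d r (vp p q) + _ = _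
  rw [modelOp_vp]
  rfl

/-! ### The homomorphism from the induced module to the model -/

/-- The universal property lifts `L → S` to the enveloping algebra; followed by the inclusion of
`S`, the lift is the identity by uniqueness. -/
theorem uea_mem {L : Type*} [LieRing L] [LieAlgebra ℂ L]
    (S : Subalgebra ℂ (UniversalEnvelopingAlgebra ℂ L))
    (h : ∀ x, UniversalEnvelopingAlgebra.ι ℂ x ∈ S) (u : UniversalEnvelopingAlgebra ℂ L) :
    u ∈ S := by
  let f : L →ₗ⁅ℂ⁆ S :=
    { toFun := fun x => ⟨UniversalEnvelopingAlgebra.ι ℂ x, h x⟩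
      map_add' := fun x y => Subtype.ext (map_add _ x y)
      map_smul' := fun c x => Subtype.ext (map_smul _ c x)
      map_lie' := fun {x y} => Subtype.ext (LieHom.map_lie _ x y) }
  have hf : S.val.comp (UniversalEnvelopingAlgebra.lift ℂ f) = AlgHom.id ℂ _ := by
    apply UniversalEnvelopingAlgebra.hom_ext
    ext x
    change ((UniversalEnvelopingAlgebra.lift ℂ f (UniversalEnvelopingAlgebra.ι ℂ x) : S) :
      UniversalEnvelopingAlgebra ℂ L) = UniversalEnvelopingAlgebra.ι ℂ x
    rw [UniversalEnvelopingAlgebra.lift_ι_apply]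
    rfl
  have h2 := congrArg (fun F => F u) hf
  change ((UniversalEnvelopingAlgebra.lift ℂ f u : S) : UniversalEnvelopingAlgebra ℂ L) = u at h2
  rw [← h2]
  exact Subtype.property _

/-- The constant $1$ is a vacuum vector: vector fields kill it, and a contraction with a nonnegative
mode is just its vacuum expectation. The total scalar is $r+(1-r)=1$ times that expectation. -/
theorem modelRep_plus {d : ℕ} {r : ℂ} {x : calL d} (hx : (x : HeisU d) ∈ calLplus d) :
    modelRep d r (toLr r x) 1 = proj2 d x • 1 := by
  rw [modelRep_apply, proj2_eq_vev]
  obtain ⟨x, hx'⟩ := x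
  change x ∈ calLplus d at hx
  change modelOp d r x 1 + ((1 - r) * vev d x) • (1 : Pol d) = vev d x • 1
  clear hx'
  rw [calLplus, ← Submodule.span_union] at hx
  have key : ∀ p q : Fin d × ℤ, 0 ≤ p.2 ∨ 0 ≤ q.2 →
      modelOp d r (vp p q) 1 + ((1 - r) * vev d (vp p q)) • (1 : Pol d) = vev d (vp p q) • 1 := by
    intro p q h
    rw [modelOp_vp, quadOp_apply, contr_eq, if_neg (by omega)]
    simp only [Derivation.map_one_eq_zero, smul_eq_C_mul, C_mul, C_sub, C_1]
    ring
  induction hx using Submodule.span_induction with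
  | mem x h =>
    rcases h with (⟨i, m, n, -, h, rfl⟩ | ⟨i, j, m, n, -, h, rfl⟩) | rfl
    · exact key (i, m) (i, n) h
    · exact key (i, m) (j, n) h
    · rw [modelOp_one, vev_one, LinearMap.smul_apply, Module.End.one_apply]
      module
  | zero => simp
  | add x y _ _ hx hy =>
    rw [map_add, map_add, LinearMap.add_apply, add_smul, ← hx, ← hy]
    module
  | smul a x _ hx =>
    rw [map_smul, map_smul, LinearMap.smul_apply, smul_eq_mul, mul_smul a, ← hx]
    module

/-- The action of `U(𝓛_r)` on the model. -/
def modelAlg (d : ℕ) (r : ℂ) :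
    UniversalEnvelopingAlgebra ℂ (LieLr d r) →ₐ[ℂ] Module.End ℂ (Pol d) :=
  UniversalEnvelopingAlgebra.lift ℂ (modelRep d r)

theorem modelAlg_ι {d : ℕ} {r : ℂ} (x : LieLr d r) :
    modelAlg d r (UniversalEnvelopingAlgebra.ι ℂ x) = modelRep d r x :=
  UniversalEnvelopingAlgebra.lift_ι_apply _ _ _

theorem modelAlg_envIncl {d : ℕ} {r : ℂ} (u : UniversalEnvelopingAlgebra ℂ (LrPlus d r)) :
    modelAlg d r (envIncl (LrPlus d r) u) 1 = vacAlg d r u • 1 := by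
  let S : Subalgebra ℂ (UniversalEnvelopingAlgebra ℂ (LrPlus d r)) :=
    { carrier := {u | modelAlg d r (envIncl (LrPlus d r) u) 1 = vacAlg d r u • 1}
      mul_mem' := by
        intro a b ha hb
        change _ = _ at ha
        change _ = _ at hb
        change _ = _
        rw [map_mul, map_mul, Module.End.mul_apply, hb, map_smul, ha, map_mul, smul_smul, mul_comm]
      add_mem' := by
        intro a b ha hb
        change _ = _ at ha
        change _ = _ at hb
        change _ = _
        rw [map_add, map_add, LinearMap.add_apply, hb, ha, map_add, add_smul]
      algebraMap_mem' := by
        intro c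
        change _ = _
        simp [Algebra.algebraMap_eq_smul_one] }
  refine uea_mem S (fun x => ?_) u
  change modelAlg d r (envIncl _ _) 1 = vacAlg d r _ • 1
  rw [envIncl_ι, modelAlg_ι, vacAlg, UniversalEnvelopingAlgebra.lift_ι_apply]
  exact modelRep_plus x.2

open scoped TensorProduct in
/-- The map `u ⊗ z ↦ z u · 1` to the model. -/
def tensorToModel (d : ℕ) (r : ℂ) :
    UniversalEnvelopingAlgebra ℂ (LieLr d r) ⊗[ℂ] ℂ →ₗ[ℂ] Pol d :=
  (LinearMap.applyₗ (1 : Pol d)) ∘ₗ (modelAlg d r).toLinearMap ∘ₗ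
    (TensorProduct.rid ℂ (UniversalEnvelopingAlgebra ℂ (LieLr d r))).toLinearMap

open scoped TensorProduct in
theorem tensorToModel_tmul {d : ℕ} {r : ℂ} (u : UniversalEnvelopingAlgebra ℂ (LieLr d r)) (z : ℂ) :
    tensorToModel d r (u ⊗ₜ[ℂ] z) = z • modelAlg d r u 1 := by
  change modelAlg d r (TensorProduct.rid ℂ _ (u ⊗ₜ[ℂ] z)) 1 = _
  rw [TensorProduct.rid_tmul, map_smul, LinearMap.smul_apply]

open scoped TensorProduct in
theorem tensorToModel_smul {d : ℕ} {r : ℂ} (u : UniversalEnvelopingAlgebra ℂ (LieLr d r))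
    (t : UniversalEnvelopingAlgebra ℂ (LieLr d r) ⊗[ℂ] ℂ) :
    tensorToModel d r (u • t) = modelAlg d r u (tensorToModel d r t) := by
  induction t using TensorProduct.induction_on with
  | zero => simp
  | tmul v z =>
    rw [TensorProduct.smul_tmul', smul_eq_mul, tensorToModel_tmul, tensorToModel_tmul, map_mul,
      Module.End.mul_apply, map_smul]
  | add s t hs ht => rw [smul_add, map_add, hs, ht, map_add, map_add]

theorem balanced_le_ker (d : ℕ) (r : ℂ) :
    (balanced d r).restrictScalars ℂ ≤ LinearMap.ker (tensorToModel d r) := by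
  intro t ht
  rw [Submodule.restrictScalars_mem, balanced] at ht
  rw [LinearMap.mem_ker]
  induction ht using Submodule.span_induction with
  | mem x h =>
    obtain ⟨u, u', z, rfl⟩ := h
    rw [map_sub, tensorToModel_tmul, tensorToModel_tmul, map_mul, Module.End.mul_apply,
      modelAlg_envIncl, map_smul, smul_smul, mul_comm, sub_self]
  | zero => simp
  | add x y _ _ hx hy => rw [map_add, hx, hy, add_zero]
  | smul a x _ hx => rw [tensorToModel_smul, hx, map_zero]

/-- The homomorphism from `M_r` to the model with `𝟏 ↦ 1`. -/
def toModel (d : ℕ) (r : ℂ) : Mr d r →ₗ[ℂ] Pol d where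
  toFun := Quotient.lift (tensorToModel d r) (by
    intro a b h
    have h2 : a - b ∈ balanced d r := (Submodule.quotientRel_def _).mp h
    have h3 : a - b ∈ LinearMap.ker (tensorToModel d r) := balanced_le_ker d r h2
    rwa [LinearMap.mem_ker, map_sub, sub_eq_zero] at h3)
  map_add' := by
    intro x y
    induction x using Submodule.Quotient.induction_on
    induction y using Submodule.Quotient.induction_on
    exact map_add (tensorToModel d r) _ _
  map_smul' := by
    intro c x
    induction x using Submodule.Quotient.induction_on
    exact map_smul (tensorToModel d r) _ _

theorem toModel_mk {d : ℕ} {r : ℂ} (t) :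
    toModel d r (Submodule.Quotient.mk t) = tensorToModel d r t := rfl

theorem toModel_vac (d : ℕ) (r : ℂ) : toModel d r (vac d r) = 1 := by
  rw [vac, toModel_mk, tensorToModel_tmul, one_smul, map_one (modelAlg d r), Module.End.one_apply]

theorem toModel_smul {d : ℕ} {r : ℂ} (u : UniversalEnvelopingAlgebra ℂ (LieLr d r))
    (m : Mr d r) : toModel d r (u • m) = modelAlg d r u (toModel d r m) := by
  induction m using Submodule.Quotient.induction_on
  exact tensorToModel_smul _ _

theorem toModel_lie {d : ℕ} {r : ℂ} (x : LieLr d r) (m : Mr d r) :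
    toModel d r ⁅x, m⁆ = modelRep d r x (toModel d r m) := by
  rw [lie_Mr, toModel_smul, modelAlg_ι]

/-! ### The parametrization of the induced module by polynomials -/

theorem lie_vac {d : ℕ} {r : ℂ} {x : calL d} (hx : (x : HeisU d) ∈ calLplus d) :
    ⁅toLr r x, vac d r⁆ = proj2 d x • vac d r := by
  let x' : LrPlus d r := ⟨toLr r x, hx⟩
  have h : (UniversalEnvelopingAlgebra.ι ℂ (toLr r x) ⊗ₜ[ℂ] (1 : ℂ) - 1 ⊗ₜ[ℂ] proj2 d x) ∈
      balanced d r := by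
    refine Submodule.subset_span ⟨1, UniversalEnvelopingAlgebra.ι ℂ x', 1, ?_⟩
    rw [envIncl_ι, one_mul, vacAlg, UniversalEnvelopingAlgebra.lift_ι_apply, mul_one]
    rfl
  have h2 := (Submodule.Quotient.eq _).mpr h
  have h3 : (1 : UniversalEnvelopingAlgebra ℂ (LieLr d r)) ⊗ₜ[ℂ] proj2 d x =
      proj2 d x • (1 ⊗ₜ[ℂ] (1 : ℂ)) := by
    rw [← TensorProduct.tmul_smul, smul_eq_mul, mul_one]
  rw [h3] at h2
  have h4 : UniversalEnvelopingAlgebra.ι ℂ (toLr r x) ⊗ₜ[ℂ] (1 : ℂ) =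
      UniversalEnvelopingAlgebra.ι ℂ (toLr r x) • (1 ⊗ₜ[ℂ] (1 : ℂ)) := by
    rw [TensorProduct.smul_tmul', smul_eq_mul, mul_one]
  rw [h4] at h2
  exact h2

theorem lie_vpL {d : ℕ} (r : ℂ) (u v p q : Fin d × ℤ) :
    ⁅vpL r u v, vpL r p q⁆ = pairing v p • vpL r u q + pairing u p • vpL r v q +
      pairing v q • vpL r p u + pairing u q • vpL r p v +
      ((r - 1) * vev d (vp u v * vp p q - vp p q * vp u v)) • toLr r (oneL d) := by
  rw [vpL, vpL, vL, vL, lie_def, bracketr_eq, proj2_eq_vev, map_add, map_smul]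
  congr 1
  exact Subtype.ext (vp_comm u v p q)

theorem vpL_swap {d : ℕ} (r : ℂ) (p q : Fin d × ℤ) :
    vpL r p q = vpL r q p + pairing p q • toLr r (oneL d) := by
  refine Subtype.ext ?_
  have := vp_sub_swap p q
  rw [sub_eq_iff_eq_add'] at this
  exact this

theorem lie_vpL_cre {d : ℕ} (r : ℂ) (a b c e : Fin d × ℕ) :
    ⁅vpL r (cre a) (cre b), vpL r (cre c) (cre e)⁆ = 0 := by
  rw [lie_vpL, vp_comm]
  simp [pairing_cre_cre]

theorem lie_oneL {d : ℕ} (r : ℂ) (x : LieLr d r) : ⁅toLr r (oneL d), x⁆ = 0 := by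
  obtain ⟨x, rfl⟩ := (toLr r).surjective x
  have : commL (oneL d) x = 0 := Subtype.ext (by simp [commL, oneL])
  rw [lie_def, bracketr_eq, this]
  simp

/-- The action of a creation operator on `M_r`. -/
def creOp (d : ℕ) (r : ℂ) (s : Sym2 (Fin d × ℕ)) : Module.End ℂ (Mr d r) :=
  LieModule.toEnd ℂ (LieLr d r) (Mr d r) (Sym2.lift ⟨fun a b => vpL r (cre a) (cre b), fun a b => by
    change vpL r (cre a) (cre b) = vpL r (cre b) (cre a)
    rw [vpL_swap, pairing_cre_cre, zero_smul, add_zero]⟩ s)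

theorem creOp_mk {d : ℕ} {r : ℂ} (a b : Fin d × ℕ) (m : Mr d r) :
    creOp d r s(a, b) m = ⁅vpL r (cre a) (cre b), m⁆ := rfl

theorem creOp_comm {d : ℕ} {r : ℂ} (s t : Sym2 (Fin d × ℕ)) :
    creOp d r s * creOp d r t = creOp d r t * creOp d r s := by
  induction s with | _ a b
  induction t with | _ c e
  refine LinearMap.ext fun m => ?_
  rw [Module.End.mul_apply, Module.End.mul_apply, creOp_mk, creOp_mk, creOp_mk, creOp_mk,
    leibniz_lie, lie_vpL_cre, zero_lie, zero_add]

/-- Creation operators commute, so they generate a commutative algebra, in which polynomials can be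
evaluated and then applied to $\mathbf 1$. -/
theorem exists_fromPol (d : ℕ) (r : ℂ) : ∃ φ : Pol d →ₗ[ℂ] Mr d r,
    φ 1 = vac d r ∧ ∀ s f, φ (X s * f) = creOp d r s (φ f) := by
  have hc : ∀ a ∈ Set.range (creOp d r), ∀ b ∈ Set.range (creOp d r), a * b = b * a := by
    rintro _ ⟨s, rfl⟩ _ ⟨t, rfl⟩
    exact creOp_comm s t
  have := Algebra.isMulCommutative_adjoin ℂ hc
  let : CommRing (Algebra.adjoin ℂ (Set.range (creOp d r))) :=
    { (Algebra.adjoin ℂ (Set.range (creOp d r))).toRing with mul_comm := mul_comm' }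
  let F : Pol d →ₐ[ℂ] Algebra.adjoin ℂ (Set.range (creOp d r)) :=
    aeval fun s => ⟨creOp d r s, Algebra.subset_adjoin ⟨s, rfl⟩⟩
  refine ⟨(LinearMap.applyₗ (vac d r)) ∘ₗ (Subalgebra.val _).toLinearMap ∘ₗ F.toLinearMap, ?_, ?_⟩
  · change ((F 1 : Algebra.adjoin ℂ (Set.range (creOp d r))) : Module.End ℂ (Mr d r)) _ = _
    rw [map_one]
    rfl
  · intro s f
    change ((F (X s * f) : Algebra.adjoin ℂ (Set.range (creOp d r))) : Module.End ℂ (Mr d r)) _ = _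
    rw [map_mul, aeval_X]
    rfl

/-- The parametrization of `M_r` by polynomials in the creation operators. -/
def fromPol (d : ℕ) (r : ℂ) : Pol d →ₗ[ℂ] Mr d r := (exists_fromPol d r).choose

theorem fromPol_one (d : ℕ) (r : ℂ) : fromPol d r 1 = vac d r :=
  (exists_fromPol d r).choose_spec.1

theorem fromPol_X_mul {d : ℕ} {r : ℂ} (a b : Fin d × ℕ) (f : Pol d) :
    fromPol d r (X s(a, b) * f) = ⁅vpL r (cre a) (cre b), fromPol d r f⁆ :=
  (exists_fromPol d r).choose_spec.2 _ _

/-! ### Creation words on the vacuum span the induced module -/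

theorem mem_of_forall_vpL_mem {d : ℕ} {r : ℂ} (S : Submodule ℂ (LieLr d r))
    (h : ∀ p q, vpL r p q ∈ S) (h1 : toLr r (oneL d) ∈ S) (x : LieLr d r) : x ∈ S := by
  obtain ⟨⟨y, hy⟩, rfl⟩ := (toLr r).surjective x
  have h2 : calL d ≤ (S.comap (toLr r).toLinearMap).map (calL d).subtype := by
    conv_lhs => rw [span_vp_eq]
    rw [Submodule.span_le]
    rintro _ (⟨⟨p, q⟩, rfl⟩ | rfl)
    · exact ⟨_, h p q, rfl⟩
    · exact ⟨_, h1, rfl⟩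
  obtain ⟨z, hz, hzy⟩ := h2 hy
  have : z = ⟨y, hy⟩ := Subtype.ext hzy
  rw [← this]
  exact hz

/-- Moves `y` past the creation operators one at a time until it meets $\mathbf 1$. Only the
commutators need control, which lets the cases below build on one another by the number of creation
modes in `y`. -/
theorem lie_fromPol_mem_of_comm {d : ℕ} {r : ℂ} {y : LieLr d r}
    (h1 : ⁅y, vac d r⁆ ∈ LinearMap.range (fromPol d r))
    (h2 : ∀ (a b : Fin d × ℕ) (f : Pol d),
      ⁅⁅y, vpL r (cre a) (cre b)⁆, fromPol d r f⁆ ∈ LinearMap.range (fromPol d r))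
    (f : Pol d) : ⁅y, fromPol d r f⁆ ∈ LinearMap.range (fromPol d r) := by
  induction f using MvPolynomial.induction_on with
  | C c =>
    rw [← mul_one (C c), ← smul_eq_C_mul, map_smul, fromPol_one, lie_smul]
    exact Submodule.smul_mem _ _ h1
  | add f g hf hg =>
    rw [map_add, lie_add]
    exact add_mem hf hg
  | mul_X f s hf =>
    induction s with | _ a b
    rw [mul_comm, fromPol_X_mul, leibniz_lie]
    refine add_mem (h2 a b f) ?_
    obtain ⟨g, hg⟩ := hf
    rw [← hg, ← fromPol_X_mul]
    exact ⟨_, rfl⟩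

theorem lie_vac_mem_range {d : ℕ} {r : ℂ} (p q : Fin d × ℤ) (h : 0 ≤ p.2 ∨ 0 ≤ q.2) :
    ⁅vpL r p q, vac d r⁆ ∈ LinearMap.range (fromPol d r) := by
  rw [vpL, vL, lie_vac (vv_mem_calLplus _ _ _ _ h), ← fromPol_one]
  exact Submodule.smul_mem _ _ ⟨1, rfl⟩

theorem lie_oneL_fromPol_mem {d : ℕ} {r : ℂ} (f : Pol d) :
    ⁅toLr r (oneL d), fromPol d r f⁆ ∈ LinearMap.range (fromPol d r) := by
  refine lie_fromPol_mem_of_comm ?_ (fun a b f => ?_) f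
  · rw [lie_vac, ← fromPol_one]
    · exact Submodule.smul_mem _ _ ⟨1, rfl⟩
    · exact Submodule.mem_sup_right (Submodule.mem_span_singleton_self 1)
  · rw [lie_oneL, zero_lie]
    exact zero_mem _

theorem lie_cre_cre_fromPol_mem {d : ℕ} {r : ℂ} (a b : Fin d × ℕ) (f : Pol d) :
    ⁅vpL r (cre a) (cre b), fromPol d r f⁆ ∈ LinearMap.range (fromPol d r) :=
  ⟨X s(a, b) * f, fromPol_X_mul a b f⟩

theorem lie_cre_fromPol_mem {d : ℕ} {r : ℂ} (c : Fin d × ℕ) (q : Fin d × ℤ) (f : Pol d) :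
    ⁅vpL r (cre c) q, fromPol d r f⁆ ∈ LinearMap.range (fromPol d r) := by
  rcases eq_cre_or_nonneg q with ⟨e, rfl⟩ | hq
  · exact lie_cre_cre_fromPol_mem c e f
  refine lie_fromPol_mem_of_comm (lie_vac_mem_range _ _ (Or.inr hq)) (fun a b f => ?_) f
  rw [lie_vpL, pairing_cre_cre, pairing_cre_cre, zero_smul, zero_smul, add_zero, add_zero]
  simp only [add_lie, smul_lie]
  exact add_mem (add_mem (Submodule.smul_mem _ _ (lie_cre_cre_fromPol_mem _ _ _))
    (Submodule.smul_mem _ _ (lie_cre_cre_fromPol_mem _ _ _)))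
    (Submodule.smul_mem _ _ (lie_oneL_fromPol_mem _))

theorem lie_right_cre_fromPol_mem {d : ℕ} {r : ℂ} (p : Fin d × ℤ) (c : Fin d × ℕ) (f : Pol d) :
    ⁅vpL r p (cre c), fromPol d r f⁆ ∈ LinearMap.range (fromPol d r) := by
  rw [vpL_swap, add_lie, smul_lie]
  exact add_mem (lie_cre_fromPol_mem _ _ _) (Submodule.smul_mem _ _ (lie_oneL_fromPol_mem _))

/-- Each quadratic term of the commutator with a creation pair retains one creation mode, so the
case of at least one such mode applies. -/
theorem lie_vpL_fromPol_mem {d : ℕ} {r : ℂ} (p q : Fin d × ℤ) (f : Pol d) :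
    ⁅vpL r p q, fromPol d r f⁆ ∈ LinearMap.range (fromPol d r) := by
  rcases eq_cre_or_nonneg p with ⟨a, rfl⟩ | hp
  · exact lie_cre_fromPol_mem _ _ _
  refine lie_fromPol_mem_of_comm (lie_vac_mem_range _ _ (Or.inl hp)) (fun a b f => ?_) f
  rw [lie_vpL]
  simp only [add_lie, smul_lie]
  exact add_mem (add_mem (add_mem (add_mem
    (Submodule.smul_mem _ _ (lie_right_cre_fromPol_mem _ _ _))
    (Submodule.smul_mem _ _ (lie_right_cre_fromPol_mem _ _ _)))
    (Submodule.smul_mem _ _ (lie_cre_fromPol_mem _ _ _)))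
    (Submodule.smul_mem _ _ (lie_cre_fromPol_mem _ _ _)))
    (Submodule.smul_mem _ _ (lie_oneL_fromPol_mem _))

theorem lie_fromPol_mem {d : ℕ} {r : ℂ} (x : LieLr d r) (f : Pol d) :
    ⁅x, fromPol d r f⁆ ∈ LinearMap.range (fromPol d r) := by
  let S : Submodule ℂ (LieLr d r) := (LinearMap.range (fromPol d r)).comap
    ((LieModule.toEnd ℂ (LieLr d r) (Mr d r)).toLinearMap.flip (fromPol d r f))
  exact mem_of_forall_vpL_mem S (fun p q => lie_vpL_fromPol_mem p q f) (lie_oneL_fromPol_mem f) x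

theorem smul_mem_of_forall_lie_mem {d : ℕ} {r : ℂ} (P : Submodule ℂ (Mr d r))
    (hP : ∀ (x : LieLr d r), ∀ m ∈ P, ⁅x, m⁆ ∈ P)
    (u : UniversalEnvelopingAlgebra ℂ (LieLr d r)) : ∀ m ∈ P, u • m ∈ P := by
  let S : Subalgebra ℂ (UniversalEnvelopingAlgebra ℂ (LieLr d r)) :=
    { carrier := {u | ∀ m ∈ P, u • m ∈ P}
      mul_mem' := by
        intro a b ha hb m hm
        rw [mul_smul]
        exact ha _ (hb _ hm)
      add_mem' := by
        intro a b ha hb m hm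
        rw [add_smul]
        exact add_mem (ha _ hm) (hb _ hm)
      algebraMap_mem' := by
        intro c m hm
        rw [algebraMap_smul]
        exact P.smul_mem c hm }
  exact uea_mem S hP u

open scoped TensorProduct in
theorem fromPol_surjective (d : ℕ) (r : ℂ) : Function.Surjective (fromPol d r) := by
  intro m
  change m ∈ LinearMap.range (fromPol d r)
  induction m using Submodule.Quotient.induction_on with | _ t
  induction t using TensorProduct.induction_on with
  | zero => exact zero_mem _
  | tmul u z =>
    have h : u • vac d r ∈ LinearMap.range (fromPol d r) := by
      refine smul_mem_of_forall_lie_mem _ ?_ u _ ⟨1, fromPol_one d r⟩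
      rintro x _ ⟨f, rfl⟩
      exact lie_fromPol_mem x f
    have h2 : (Submodule.Quotient.mk (u ⊗ₜ[ℂ] z) : Mr d r) = z • (u • vac d r) := by
      have h3 : u ⊗ₜ[ℂ] z =
          z • (u • ((1 : UniversalEnvelopingAlgebra ℂ (LieLr d r)) ⊗ₜ[ℂ] (1 : ℂ))) := by
        rw [TensorProduct.smul_tmul', ← TensorProduct.tmul_smul, smul_eq_mul, smul_eq_mul, mul_one,
          mul_one]
      rw [h3]
      rfl
    exact h2 ▸ Submodule.smul_mem _ z h
  | add s t hs ht => exact add_mem hs ht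

/-! ### Jucys–Murphy elements have integer eigenvalues -/

theorem swap_sum_comm {α F : Type*} [DecidableEq α] [AddCommGroup F] [Module ℂ F]
    (ρ : Equiv.Perm α →* Module.End ℂ F) {T : Finset α} {c y z : α} (hc : c ∈ T) (hy : y ∈ T)
    (hz : z ∉ T) :
    ρ (Equiv.swap c y) * ∑ e ∈ T, ρ (Equiv.swap e z) =
      (∑ e ∈ T, ρ (Equiv.swap e z)) * ρ (Equiv.swap c y) := by
  have hzc : z ≠ c := fun h => hz (h ▸ hc)
  have hzy : z ≠ y := fun h => hz (h ▸ hy)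
  rw [Finset.mul_sum, Finset.sum_mul]
  refine Finset.sum_equiv (Equiv.swap c y) (fun e => ?_) (fun e _ => ?_)
  · have h : ∀ e ∈ T, Equiv.swap c y e ∈ T := by
      intro e he
      rw [Equiv.swap_apply_def]
      split_ifs <;> assumption
    exact ⟨h e, fun he => Equiv.swap_apply_self c y e ▸ h _ he⟩
  · rw [← map_mul, ← map_mul, Equiv.mul_swap_eq_swap_mul, Equiv.swap_apply_of_ne_of_ne hzc hzy]

/-- The Okounkov–Vershik argument, by induction on `T`. For $T\cup\{y\}$ let $J$ be the sum of
transpositions with $z$, $J'$ the sum over $T$ of transpositions with $y$, and $s=(y\,z)$. Then $J$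
and $J'$ commute and $J's=sJ-1$, so eigenvalues of $J$ can be compared with those of $J'$, which are
integers by induction. -/
theorem jucysMurphy_eigenvalue_int {α F : Type*} [DecidableEq α] [AddCommGroup F] [Module ℂ F]
    (ρ : Equiv.Perm α →* Module.End ℂ F) (V : Submodule ℂ F) [FiniteDimensional ℂ V]
    (T : Finset α) : ∀ z ∉ T,
    (∀ a ∈ insert z T, ∀ b ∈ insert z T, ∀ v ∈ V, ρ (Equiv.swap a b) v ∈ V) →
    ∀ (t : ℂ), ∀ v ∈ V, v ≠ 0 → (∑ c ∈ T, ρ (Equiv.swap c z)) v = t • v → ∃ k : ℤ, t = k := by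
  induction T using Finset.induction_on with
  | empty =>
    intro z _ _ t v _ hv0 hv
    rw [Finset.sum_empty, LinearMap.zero_apply, eq_comm, smul_eq_zero] at hv
    exact ⟨0, by simpa using hv.resolve_right hv0⟩
  | insert y T hy ih =>
    intro z hz hV t v hvV hv0 hv
    have hzy : z ≠ y := fun h => hz (h ▸ Finset.mem_insert_self _ _)
    have hzT : z ∉ T := fun h => hz (Finset.mem_insert_of_mem h)
    set s := ρ (Equiv.swap y z) with hs
    set J' := ∑ c ∈ T, ρ (Equiv.swap c y) with hJ'
    set J := ∑ c ∈ insert y T, ρ (Equiv.swap c z) with hJ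
    have hss : ∀ w, s (s w) = w := by
      intro w
      rw [← Module.End.mul_apply, hs, ← map_mul, Equiv.swap_mul_self, map_one, Module.End.one_apply]
    have hJs : ∀ w, J' (s w) = s (J w) - w := by
      intro w
      have h1 : J' * s = s * ∑ c ∈ T, ρ (Equiv.swap c z) := by
        rw [hJ', hs, Finset.sum_mul, Finset.mul_sum]
        refine Finset.sum_congr rfl fun c hc => ?_
        have hcy : c ≠ y := fun h => hy (h ▸ hc)
        have hcz : c ≠ z := fun h => hzT (h ▸ hc)
        rw [← map_mul, ← map_mul, Equiv.mul_swap_eq_swap_mul (Equiv.swap y z),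
          Equiv.swap_apply_of_ne_of_ne hcy hcz, Equiv.swap_apply_right]
      have h2 : J = s + ∑ c ∈ T, ρ (Equiv.swap c z) := by rw [hJ, Finset.sum_insert hy]
      rw [h2, LinearMap.add_apply, map_add, hss, add_sub_cancel_left]
      exact LinearMap.congr_fun h1 w
    have hcomm : ∀ w, J (J' w) = J' (J w) := by
      intro w
      have h1 : J' * J = J * J' := by
        rw [hJ', Finset.sum_mul, Finset.mul_sum]
        exact Finset.sum_congr rfl fun c hc => swap_sum_comm ρ (Finset.mem_insert_of_mem hc)
          (Finset.mem_insert_self _ _) hz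
      exact (LinearMap.congr_fun h1 w).symm
    have hVJ' : ∀ w ∈ V, J' w ∈ V := by
      intro w hw
      rw [hJ', LinearMap.sum_apply]
      exact sum_mem fun c hc => hV _ (by simp [hc]) _ (by simp) _ hw
    have ih' := ih y hy fun a ha b hb => hV a (Finset.mem_insert_of_mem ha) b
      (Finset.mem_insert_of_mem hb)
    let W : Submodule ℂ F := V ⊓ LinearMap.ker (J - t • 1)
    have hW : ∀ w, w ∈ W ↔ w ∈ V ∧ J w = t • w := by
      intro w
      simp only [W, Submodule.mem_inf, LinearMap.mem_ker, LinearMap.sub_apply,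
        LinearMap.smul_apply, Module.End.one_apply, sub_eq_zero]
    have hWJ' : ∀ w ∈ W, J' w ∈ W := by
      intro w hw
      rw [hW] at hw ⊢
      exact ⟨hVJ' w hw.1, by rw [hcomm, hw.2, map_smul]⟩
    have : FiniteDimensional ℂ W := Submodule.finiteDimensional_inf_left _ _
    have : Nontrivial W := ⟨⟨v, (hW v).mpr ⟨hvV, hv⟩⟩, 0, fun h => hv0 (congrArg Subtype.val h)⟩
    -- $J'$ preserves the $t$-eigenspace of $J$ in `V`; this gives a joint eigenvector $w$ with
    -- $J'w=aw$.
    obtain ⟨a, ha⟩ := Module.End.exists_eigenvalue (J'.restrict hWJ')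
    obtain ⟨⟨w, hwW⟩, hw⟩ := ha.exists_hasEigenvector
    have hw0 : w ≠ 0 := fun h => hw.2 (Subtype.ext h)
    have hJ'w : J' w = a • w := congrArg Subtype.val hw.apply_eq_smul
    obtain ⟨hwV, hJw⟩ := (hW w).mp hwW
    obtain ⟨k, hk⟩ := ih' a w hwV hw0 hJ'w
    by_cases hat : a = t
    · exact ⟨k, hat ▸ hk⟩
    have hat' : a - t ≠ 0 := sub_ne_zero.mpr hat
    -- On the span of $w$ and $sw$, this vector is the candidate eigenvector of $J'$ for the
    -- eigenvalue $t$. If it is zero, $w$ is an eigenvector of $s$, and $s^2=1$ forces $a-t=\pm1$.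
    by_cases hu : s w + (a - t)⁻¹ • w = 0
    · have h1 : s w = (-(a - t)⁻¹) • w := by
        rw [neg_smul]
        exact eq_neg_of_add_eq_zero_left hu
      have h2 := hss w
      rw [h1, map_smul, h1, smul_smul, ← sub_eq_zero, ← one_smul ℂ w, smul_smul, ← sub_smul,
        smul_eq_zero] at h2
      have h3 := h2.resolve_right hw0
      have h4 : (a - t) * (a - t) = 1 := by
        field_simp at h3
        linear_combination -h3
      rcases mul_self_eq_one_iff.mp h4 with h | h
      · exact ⟨k - 1, by push_cast; linear_combination hk - h⟩
      · exact ⟨k + 1, by push_cast; linear_combination hk - h⟩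
    · refine ih' t _ (add_mem (hV y (by simp) z (by simp) w hwV) (V.smul_mem _ hwV)) hu ?_
      rw [map_add, map_smul, hJ'w, hJs, hJw, map_smul, smul_add, smul_smul, smul_smul]
      have : (a - t)⁻¹ * a = 1 + t * (a - t)⁻¹ := by
        field_simp
        ring
      rw [this]
      module

/-! ### Weight spaces of polynomials in symmetric matrix entries -/

theorem finsupp_add_single_induction {σ : Type*} {P : (σ →₀ ℕ) → Prop} (h0 : P 0)
    (h : ∀ e s, P e → P (e + Finsupp.single s 1)) (e : σ →₀ ℕ) : P e := by
  classical
  have key : ∀ M : Multiset σ, P (Multiset.toFinsupp M) := by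
    intro M
    induction M using Multiset.induction_on with
    | empty => simpa using h0
    | cons s M ih =>
      rw [← Multiset.singleton_add, map_add, Multiset.toFinsupp_singleton, add_comm]
      exact h _ _ ih
  simpa using key (Finsupp.toMultiset e)

theorem exists_eq_add_single {σ : Type*} {e : σ →₀ ℕ} {s : σ} (hs : e s ≠ 0) :
    ∃ e', e = e' + Finsupp.single s 1 := by
  classical
  refine ⟨e - Finsupp.single s 1, (tsub_add_cancel_of_le ?_).symm⟩
  rw [Finsupp.single_le_iff]
  omega

theorem toMultiset_pair_add {α : Type*} (a b : α) (m : Multiset α) :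
    s(a, b).toMultiset + m = a ::ₘ b ::ₘ m := by
  have : s(a, b).toMultiset = a ::ₘ {b} := rfl
  rw [this, Multiset.cons_add, Multiset.singleton_add]

/-- The multiset of indices occurring in a monomial. -/
def pairWt {α : Type*} : (Sym2 α →₀ ℕ) →+ Multiset α := Finsupp.weight Sym2.toMultiset

theorem pairWt_add_single {α : Type*} (e : Sym2 α →₀ ℕ) (a b : α) :
    pairWt (e + Finsupp.single s(a, b) 1) = a ::ₘ b ::ₘ pairWt e := by
  rw [map_add, pairWt, Finsupp.weight_single, one_smul, add_comm, toMultiset_pair_add]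

theorem mem_pairWt {α : Type*} {e : Sym2 α →₀ ℕ} {x : α} :
    x ∈ pairWt e ↔ ∃ s, e s ≠ 0 ∧ x ∈ s := by
  constructor
  · induction e using finsupp_add_single_induction with
    | h0 => simp
    | h e s ih =>
      induction s with | _ a b
      rw [pairWt_add_single, Multiset.mem_cons, Multiset.mem_cons]
      rintro (rfl | rfl | h)
      · exact ⟨s(x, b), by simp, by simp⟩
      · exact ⟨s(a, x), by simp, by simp⟩
      · obtain ⟨s, hs, hx⟩ := ih h
        exact ⟨s, by rw [Finsupp.add_apply]; omega, hx⟩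
  · rintro ⟨s, hs, hx⟩
    obtain ⟨e', rfl⟩ := exists_eq_add_single hs
    induction s with | _ a b
    rw [pairWt_add_single, Multiset.mem_cons, Multiset.mem_cons]
    rcases Sym2.mem_iff.mp hx with rfl | rfl <;> simp

theorem exists_pair_of_mem_pairWt {α : Type*} {e : Sym2 α →₀ ℕ} {z : α} (hz : z ∈ pairWt e) :
    ∃ b e', e = e' + Finsupp.single s(z, b) 1 := by
  obtain ⟨s, hs, hzs⟩ := mem_pairWt.mp hz
  obtain ⟨b, rfl⟩ := hzs
  obtain ⟨e', he'⟩ := exists_eq_add_single hs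
  exact ⟨b, e', he'⟩

theorem card_pairWt {α : Type*} (e : Sym2 α →₀ ℕ) :
    Multiset.card (pairWt e) = 2 * e.degree := by
  induction e using finsupp_add_single_induction with
  | h0 => simp
  | h e s ih =>
    induction s with | _ a b
    rw [pairWt_add_single, Multiset.card_cons, Multiset.card_cons, ih, map_add,
      Finsupp.degree_single]
    omega

theorem pairWt_eq_zero {α : Type*} {e : Sym2 α →₀ ℕ} (h : pairWt e = 0) : e = 0 := by
  have := card_pairWt e
  rw [h, Multiset.card_zero] at this
  exact Finsupp.degree_eq_zero_iff e |>.mp (by omega)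

/-- Only pairs of elements of `m` can occur as variables, and each exponent is at most the degree,
hence at most the size of `m`. -/
theorem finite_pairWt_eq {α : Type*} (m : Multiset α) :
    {e : Sym2 α →₀ ℕ | pairWt e = m}.Finite := by
  classical
  refine (Set.finite_Iic (∑ s ∈ m.toFinset.sym2, Finsupp.single s (Multiset.card m))).subset ?_
  rintro e rfl s
  by_cases hs : e s = 0
  · rw [hs]
    exact Nat.zero_le _
  have hmem : s ∈ (pairWt e).toFinset.sym2 := by
    rw [Finset.mem_sym2_iff]
    intro x hx
    rw [Multiset.mem_toFinset]
    exact mem_pairWt.mpr ⟨s, hs, hx⟩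
  rw [Finsupp.finsetSum_apply, Finset.sum_eq_single_of_mem s hmem, Finsupp.single_eq_same,
    card_pairWt]
  · have := Finsupp.le_degree s e
    omega
  · intro t _ ht
    exact Finsupp.single_eq_of_ne' ht

/-- Polynomials all of whose monomials have a given multiset of indices. -/
def wtSpace {α : Type*} (m : Multiset α) : Submodule ℂ (MvPolynomial (Sym2 α) ℂ) :=
  weightedHomogeneousSubmodule ℂ Sym2.toMultiset m

theorem monomial_mem_wtSpace {α : Type*} (e : Sym2 α →₀ ℕ) :
    monomial e (1 : ℂ) ∈ wtSpace (pairWt e) :=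
  isWeightedHomogeneous_monomial _ _ _ rfl

theorem wtSpace_le {α : Type*} {m : Multiset α} {P : Submodule ℂ (MvPolynomial (Sym2 α) ℂ)}
    (h : ∀ e, pairWt e = m → monomial e 1 ∈ P) : wtSpace m ≤ P := by
  intro f hf
  rw [f.as_sum]
  refine sum_mem fun e he => ?_
  have h2 : monomial e (coeff e f) = coeff e f • monomial e (1 : ℂ) := by
    rw [smul_monomial, smul_eq_mul, mul_one]
  rw [h2]
  exact P.smul_mem _ (h e (hf (mem_support_iff.mp he)))

instance {α : Type*} (m : Multiset α) : FiniteDimensional ℂ (wtSpace m) := by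
  rw [wtSpace, weightedHomogeneousSubmodule_eq_finsupp_supported]
  have := (finite_pairWt_eq m).to_subtype
  exact Module.Finite.of_basis (basisRestrictSupport ℂ {e : Sym2 α →₀ ℕ | pairWt e = m})

theorem monomial_add_single_eq {σ : Type*} (e : σ →₀ ℕ) (s : σ) :
    monomial (e + Finsupp.single s 1) (1 : ℂ) = X s * monomial e 1 := by
  rw [X, monomial_mul, one_mul, add_comm]

theorem X_mul_mem_wtSpace {α : Type*} (a b : α) {m : Multiset α} {f : MvPolynomial (Sym2 α) ℂ}
    (hf : f ∈ wtSpace m) : X s(a, b) * f ∈ wtSpace (a ::ₘ b ::ₘ m) := by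
  rw [← toMultiset_pair_add]
  exact (isWeightedHomogeneous_X ℂ Sym2.toMultiset s(a, b)).mul hf

/-- Permutations of the indices. -/
def permRep (α : Type*) : Equiv.Perm α →* Module.End ℂ (MvPolynomial (Sym2 α) ℂ) where
  toFun σ := (rename (Sym2.map σ)).toLinearMap
  map_one' := by
    refine LinearMap.ext fun f => ?_
    change rename (Sym2.map id) f = f
    rw [Sym2.map_id, rename_id_apply]
  map_mul' σ τ := by
    refine LinearMap.ext fun f => ?_
    change rename (Sym2.map (σ ∘ τ)) f = rename (Sym2.map σ) (rename (Sym2.map τ) f)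
    rw [rename_rename, Sym2.map_comp]

theorem permRep_X_mul {α : Type*} (σ : Equiv.Perm α) (a b : α) (f : MvPolynomial (Sym2 α) ℂ) :
    permRep α σ (X s(a, b) * f) = X s(σ a, σ b) * permRep α σ f := by
  change rename _ (X s(a, b) * f) = _
  rw [map_mul, rename_X]
  rfl

theorem permRep_monomial_mem {α : Type*} (σ : Equiv.Perm α) (e : Sym2 α →₀ ℕ) :
    permRep α σ (monomial e 1) ∈ wtSpace ((pairWt e).map σ) := by
  induction e using finsupp_add_single_induction with
  | h0 =>
    rw [map_zero, Multiset.map_zero]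
    change rename _ (1 : MvPolynomial (Sym2 α) ℂ) ∈ _
    rw [map_one]
    exact isWeightedHomogeneous_one _ _
  | h e s ih =>
    induction s with | _ a b
    rw [pairWt_add_single, monomial_add_single_eq, permRep_X_mul, Multiset.map_cons,
      Multiset.map_cons]
    exact X_mul_mem_wtSpace _ _ ih

theorem permRep_monomial_of_fixed {α : Type*} (σ : Equiv.Perm α) (e : Sym2 α →₀ ℕ)
    (h : ∀ x ∈ pairWt e, σ x = x) : permRep α σ (monomial e 1) = monomial e 1 := by
  induction e using finsupp_add_single_induction with
  | h0 => exact map_one (rename (R := ℂ) (Sym2.map σ))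
  | h e s ih =>
    induction s with | _ a b
    rw [pairWt_add_single] at h
    rw [monomial_add_single_eq, permRep_X_mul, ih fun x hx => h x (by simp [hx]),
      h a (by simp), h b (by simp)]

/-- With distinct indices, a transposition of two members fixes `m`; unequal multiplicities would
spoil this. -/
theorem permRep_swap_mem {α : Type*} [DecidableEq α] {m : Multiset α} (hm : m.Nodup) {a b : α}
    (ha : a ∈ m) (hb : b ∈ m) {f : MvPolynomial (Sym2 α) ℂ} (hf : f ∈ wtSpace m) :
    permRep α (Equiv.swap a b) f ∈ wtSpace m := by
  have h : m.map (Equiv.swap a b) = m := by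
    refine (Multiset.Nodup.ext (hm.map (Equiv.injective _)) hm).mpr fun x => ?_
    have h1 : ∀ x ∈ m, Equiv.swap a b x ∈ m := by
      intro x hx
      rw [Equiv.swap_apply_def]
      split_ifs <;> assumption
    rw [Multiset.mem_map]
    constructor
    · rintro ⟨y, hy, rfl⟩
      exact h1 y hy
    · exact fun hx => ⟨_, h1 x hx, Equiv.swap_apply_self a b x⟩
  have h2 : wtSpace m ≤ (wtSpace m).comap (permRep α (Equiv.swap a b)) := by
    refine wtSpace_le fun e he => ?_
    have := permRep_monomial_mem (Equiv.swap a b) e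
    rwa [he, h] at this
  exact h2 hf

/-! ### The model is generated by `1` -/

theorem contr_ann_cre {d : ℕ} (a b : Fin d × ℕ) :
    contr (ann a) (cre b) = if a = b then C ((a.2 : ℂ) + 1) else 0 := by
  have h : (0 : ℤ) ≤ (ann a).2 := by
    simp only [ann]
    omega
  rw [contr_left_nonneg h, pairing, heisCoeff]
  by_cases hab : a = b
  · subst hab
    simp [ann, cre]
  · rw [if_neg hab, if_neg, C_0]
    rintro ⟨h1, h2⟩
    refine hab (Prod.ext h1 ?_)
    simp only [ann, cre] at h2
    omega

theorem riccati_cre_ann_monomial {d : ℕ} (a c : Fin d × ℕ) (e : Sym2 (Fin d × ℕ) →₀ ℕ)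
    (hc : c ∉ pairWt e) : riccati (cre a) (ann c) (monomial e 1) = 0 := by
  induction e using finsupp_add_single_induction with
  | h0 => exact (riccati (cre a) (ann c)).map_one_eq_zero
  | h e s ih =>
    induction s with | _ x y
    rw [pairWt_add_single, Multiset.mem_cons, Multiset.mem_cons, not_or, not_or] at hc
    rw [monomial_add_single_eq, Derivation.leibniz, ih hc.2.2, riccati_X, contr_ann_cre,
      contr_ann_cre, if_neg hc.1, if_neg hc.2.1]
    simp

/-- This operator is a derivation replacing an index `c` by `a`; here `c` occurs exactly once. The
scalar is the Heisenberg pairing of the mode with its dual. -/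
theorem quadOp_cre_ann {d : ℕ} (r : ℂ) (a b c : Fin d × ℕ) (hbc : c ≠ b)
    (e : Sym2 (Fin d × ℕ) →₀ ℕ) (hc : c ∉ pairWt e) :
    quadOp r (cre a) (ann c) (X s(c, b) * monomial e 1) =
      ((c.2 : ℂ) + 1) • (X s(a, b) * monomial e 1) := by
  have h : (0 : ℤ) ≤ (ann c).2 := by
    simp only [ann]
    omega
  rw [quadOp_apply, contr_right_nonneg h, Derivation.leibniz, riccati_cre_ann_monomial a c e hc,
    riccati_X, contr_ann_cre, contr_ann_cre, if_neg hbc, if_pos rfl, contr_cre_cre, contr_cre_cre,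
    smul_eq_C_mul]
  simp only [smul_eq_mul]
  ring

theorem mem_of_fresh {d : ℕ} {r : ℂ} {I : Submodule ℂ (Pol d)}
    (hI : ∀ p q, ∀ f ∈ I, quadOp r p q f ∈ I) (a b c : Fin d × ℕ) (hbc : c ≠ b)
    (e : Sym2 (Fin d × ℕ) →₀ ℕ) (hc : c ∉ pairWt e) (h : X s(c, b) * monomial e 1 ∈ I) :
    X s(a, b) * monomial e 1 ∈ I := by
  have h2 := hI (cre a) (ann c) _ h
  rw [quadOp_cre_ann r a b c hbc e hc] at h2
  have h3 : ((c.2 : ℂ) + 1) ≠ 0 := Nat.cast_add_one_ne_zero _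
  have h4 := I.smul_mem ((c.2 : ℂ) + 1)⁻¹ h2
  rwa [smul_smul, inv_mul_cancel₀ h3, one_smul] at h4

/-- Polarisation: a variable $X_{ab}$ with possibly repeated indices is obtained from $X_{cf}$ with
fresh `c`, `f` by two index replacements. The multilinear factor `e'` stores the fresh variables not
yet specialised. -/
theorem mem_of_multilinear_mem {d : ℕ} {r : ℂ} {I : Submodule ℂ (Pol d)}
    (hI : ∀ p q, ∀ f ∈ I, quadOp r p q f ∈ I)
    (h : ∀ e : Sym2 (Fin d × ℕ) →₀ ℕ, (pairWt e).Nodup → monomial e 1 ∈ I) :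
    ∀ e e' : Sym2 (Fin d × ℕ) →₀ ℕ, (pairWt e').Nodup → monomial (e + e') 1 ∈ I := by
  intro e
  induction e using finsupp_add_single_induction with
  | h0 =>
    intro e' he'
    rw [zero_add]
    exact h e' he'
  | h e s ih =>
    intro e' he'
    induction s with | _ a b
    have : Nonempty (Fin d) := ⟨a.1⟩
    obtain ⟨c, hc⟩ := Infinite.exists_notMem_finset (pairWt (e + e') + {a, b}).toFinset
    obtain ⟨f, hf⟩ := Infinite.exists_notMem_finset (pairWt (e + e') + {a, b, c}).toFinset
    simp only [map_add, Multiset.mem_toFinset, Multiset.mem_add, Multiset.insert_eq_cons,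
      Multiset.mem_cons, Multiset.mem_singleton, not_or] at hc hf
    have h1 := ih (e' + Finsupp.single s(c, f) 1) (by
      rw [pairWt_add_single, Multiset.nodup_cons, Multiset.nodup_cons, Multiset.mem_cons]
      exact ⟨not_or.mpr ⟨Ne.symm hf.2.2.2, hc.1.2⟩, hf.1.2, he'⟩)
    rw [← add_assoc, monomial_add_single_eq, Sym2.eq_swap] at h1
    have h2 := mem_of_fresh hI b c f hf.2.2.2 (e + e') (by
      rw [map_add, Multiset.mem_add]
      exact not_or.mpr hf.1) h1
    rw [Sym2.eq_swap] at h2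
    have h3 := mem_of_fresh hI a b c hc.2.2 (e + e') (by
      rw [map_add, Multiset.mem_add]
      exact not_or.mpr hc.1) h2
    rwa [add_right_comm, monomial_add_single_eq]

/-! ### Creation operators as shifted Jucys–Murphy elements -/

theorem riccati_cre_cre_monomial {d : ℕ} (z b : Fin d × ℕ) (e : Sym2 (Fin d × ℕ) →₀ ℕ)
    (h : (z ::ₘ b ::ₘ pairWt e).Nodup) :
    riccati (cre z) (cre b) (monomial e 1) = ∑ c ∈ (pairWt e).toFinset,
      permRep _ (Equiv.swap c z) (X s(z, b) * monomial e 1) := by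
  induction e using finsupp_add_single_induction with
  | h0 =>
    rw [map_zero, Multiset.toFinset_zero, Finset.sum_empty]
    exact (riccati (cre z) (cre b)).map_one_eq_zero
  | h e s ih =>
    induction s with | _ x y
    rw [pairWt_add_single] at h ⊢
    simp only [Multiset.nodup_cons, Multiset.mem_cons, not_or] at h
    obtain ⟨⟨hzb, hzx, hzy, hze⟩, ⟨hbx, hby, hbe⟩, ⟨hxy, hxe⟩, hye, he⟩ := h
    have ih' := ih (by
      simp only [Multiset.nodup_cons, Multiset.mem_cons, not_or]
      exact ⟨⟨hzb, hze⟩, hbe, he⟩)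
    have hfix : ∀ c, c ∉ pairWt e → permRep _ (Equiv.swap c z) (monomial e 1) = monomial e 1 := by
      intro c hc
      refine permRep_monomial_of_fixed _ _ fun w hw => ?_
      exact Equiv.swap_apply_of_ne_of_ne (fun h => hc (h ▸ hw)) (fun h => hze (h ▸ hw))
    rw [Multiset.toFinset_cons, Multiset.toFinset_cons, Finset.sum_insert (by simp [hxy, hxe]),
      Finset.sum_insert (by simp [hye]), monomial_add_single_eq, Derivation.leibniz, ih',
      riccati_X, contr_cre_cre, contr_cre_cre, contr_cre_cre, contr_cre_cre]
    have hsum : ∑ c ∈ (pairWt e).toFinset, permRep _ (Equiv.swap c z)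
        (X s(z, b) * (X s(x, y) * monomial e 1)) = X s(x, y) * ∑ c ∈ (pairWt e).toFinset,
        permRep _ (Equiv.swap c z) (X s(z, b) * monomial e 1) := by
      rw [Finset.mul_sum]
      refine Finset.sum_congr rfl fun c hc => ?_
      rw [Multiset.mem_toFinset] at hc
      have hxc : x ≠ c := fun h => hxe (h ▸ hc)
      have hyc : y ≠ c := fun h => hye (h ▸ hc)
      rw [mul_left_comm, permRep_X_mul, Equiv.swap_apply_of_ne_of_ne hxc (Ne.symm hzx),
        Equiv.swap_apply_of_ne_of_ne hyc (Ne.symm hzy)]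
    rw [hsum, permRep_X_mul, permRep_X_mul, permRep_X_mul, permRep_X_mul, hfix x hxe, hfix y hye,
      Equiv.swap_apply_right, Equiv.swap_apply_right, Equiv.swap_apply_left,
      Equiv.swap_apply_left, Equiv.swap_apply_of_ne_of_ne hbx (Ne.symm hzb),
      Equiv.swap_apply_of_ne_of_ne hby (Ne.symm hzb),
      Equiv.swap_apply_of_ne_of_ne (Ne.symm hxy) (Ne.symm hzy),
      Equiv.swap_apply_of_ne_of_ne hxy (Ne.symm hzx)]
    simp only [smul_eq_mul]
    rw [Sym2.eq_swap (a := b) (b := x), Sym2.eq_swap (a := b) (b := y),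
      Sym2.eq_swap (a := x) (b := z)]
    ring

/-- The Riccati field replaces $X_{xy}$ by $X_{zx}X_{by}+X_{bx}X_{zy}$, which is what the
transpositions of $z$ with $y$ and $x$ make of $X_{zb}X_{xy}$. The transposition $(b\,z)$ fixes
$X_{zb}$ and the rest; including it completes the Jucys–Murphy sum and turns $r$ into $r-1$. -/
theorem quadOp_cre_cre_monomial {d : ℕ} (r : ℂ) (z b : Fin d × ℕ) (e : Sym2 (Fin d × ℕ) →₀ ℕ)
    (h : (z ::ₘ b ::ₘ pairWt e).Nodup) :
    quadOp r (cre z) (cre b) (monomial e 1) =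
      (r - 1) • (X s(z, b) * monomial e 1) + ∑ c ∈ (b ::ₘ pairWt e).toFinset,
        permRep _ (Equiv.swap c z) (X s(z, b) * monomial e 1) := by
  have h' := h
  simp only [Multiset.nodup_cons, Multiset.mem_cons, not_or] at h'
  obtain ⟨⟨hzb, hze⟩, hbe, he⟩ := h'
  have hfix : permRep _ (Equiv.swap b z) (monomial e 1) = monomial e 1 :=
    permRep_monomial_of_fixed _ _ fun w hw =>
      Equiv.swap_apply_of_ne_of_ne (fun h => hbe (h ▸ hw)) (fun h => hze (h ▸ hw))
  rw [Multiset.toFinset_cons, Finset.sum_insert (by simpa using hbe), quadOp_apply,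
    riccati_cre_cre_monomial z b e h, contr_cre_cre, permRep_X_mul (Equiv.swap b z), hfix,
    Equiv.swap_apply_left, Equiv.swap_apply_right, Sym2.eq_swap (a := b), sub_smul, one_smul,
    smul_eq_C_mul]
  ring

/-- Every monomial containing $z$ is $X_{zb}$ times a smaller one, so $A=(r-1)+J$ carries the weight
space into `I` by induction. A kernel vector would be a $J$-eigenvector of eigenvalue
$1-r\notin\mathbb Z$; thus $A$ is bijective on this finite-dimensional space, which then lies in
`I`. -/
theorem multilinear_mem {d : ℕ} {r : ℂ} (hr : ∀ k : ℤ, r ≠ k) {I : Submodule ℂ (Pol d)}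
    (hI : ∀ p q, ∀ f ∈ I, quadOp r p q f ∈ I) (h1 : 1 ∈ I) (n : ℕ) :
    ∀ m : Multiset (Fin d × ℕ), Multiset.card m = n → m.Nodup → wtSpace m ≤ I := by
  induction n using Nat.strong_induction_on with | _ n ih
  intro m hmn hm
  induction m using Multiset.induction_on with
  | empty =>
    refine wtSpace_le fun e he => ?_
    rw [pairWt_eq_zero he]
    exact h1
  | cons z m _ =>
    set A : Module.End ℂ (Pol d) :=
      (r - 1) • 1 + ∑ c ∈ m.toFinset, permRep _ (Equiv.swap c z) with hA
    have hAapp : ∀ f, A f = (r - 1) • f + ∑ c ∈ m.toFinset, permRep _ (Equiv.swap c z) f := by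
      intro f
      rw [hA, LinearMap.add_apply, LinearMap.sum_apply]
      rfl
    have hAI : wtSpace (z ::ₘ m) ≤ I.comap A := by
      refine wtSpace_le fun e he => ?_
      have hz : z ∈ pairWt e := by
        rw [he]
        exact Multiset.mem_cons_self _ _
      obtain ⟨b, e', rfl⟩ := exists_pair_of_mem_pairWt hz
      rw [pairWt_add_single, Multiset.cons_inj_right] at he
      subst he
      have hmem : monomial e' 1 ∈ I := ih (Multiset.card (pairWt e')) (by
        rw [← hmn, Multiset.card_cons, Multiset.card_cons]
        omega) (pairWt e') rfl (Multiset.nodup_cons.mp (Multiset.nodup_cons.mp hm).2).2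
        (monomial_mem_wtSpace e')
      rw [Submodule.mem_comap, hAapp, monomial_add_single_eq, ← quadOp_cre_cre_monomial r z b e' hm]
      exact hI _ _ _ hmem
    have hswap : ∀ a ∈ insert z m.toFinset, ∀ b ∈ insert z m.toFinset, ∀ v ∈ wtSpace (z ::ₘ m),
        permRep _ (Equiv.swap a b) v ∈ wtSpace (z ::ₘ m) := by
      intro a ha b hb v hv
      rw [← Multiset.toFinset_cons, Multiset.mem_toFinset] at ha hb
      exact permRep_swap_mem hm ha hb hv
    have hAV : ∀ v ∈ wtSpace (z ::ₘ m), A v ∈ wtSpace (z ::ₘ m) := by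
      intro v hv
      rw [hAapp]
      exact add_mem (Submodule.smul_mem _ _ hv) (sum_mem fun c hc =>
        hswap c (Finset.mem_insert_of_mem hc) z (Finset.mem_insert_self _ _) v hv)
    have hinj : Function.Injective (A.restrict hAV) := by
      rw [injective_iff_map_eq_zero]
      rintro ⟨v, hv⟩ hv0
      have hv1 : A v = 0 := congrArg Subtype.val hv0
      by_contra hne
      have hvne : v ≠ 0 := fun h => hne (Subtype.ext h)
      obtain ⟨k, hk⟩ := jucysMurphy_eigenvalue_int (permRep _) (wtSpace (z ::ₘ m)) m.toFinset z
        (by simpa using (Multiset.nodup_cons.mp hm).1) hswap (1 - r) v hv hvne (by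
          rw [hAapp] at hv1
          rw [LinearMap.sum_apply, eq_neg_of_add_eq_zero_right hv1]
          module)
      refine hr (1 - k) ?_
      push_cast
      linear_combination -hk
    have hsurj := LinearMap.injective_iff_surjective.mp hinj
    intro f hf
    obtain ⟨⟨g, hg⟩, hgf⟩ := hsurj ⟨f, hf⟩
    have : A g = f := congrArg Subtype.val hgf
    rw [← this]
    exact hAI hg

theorem eq_top_of_one_mem {d : ℕ} {r : ℂ} (hr : ∀ k : ℤ, r ≠ k) {I : Submodule ℂ (Pol d)}
    (hI : ∀ p q, ∀ f ∈ I, quadOp r p q f ∈ I) (h1 : 1 ∈ I) : I = ⊤ := by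
  have h : ∀ e : Sym2 (Fin d × ℕ) →₀ ℕ, (pairWt e).Nodup → monomial e 1 ∈ I := fun e he =>
    multilinear_mem hr hI h1 _ _ rfl he (monomial_mem_wtSpace e)
  rw [eq_top_iff]
  intro f _
  rw [f.as_sum]
  refine sum_mem fun e _ => ?_
  have h2 : monomial e (coeff e f) = coeff e f • monomial e (1 : ℂ) := by
    rw [smul_monomial, smul_eq_mul, mul_one]
  rw [h2, ← add_zero e]
  exact I.smul_mem _ (mem_of_multilinear_mem hI h e 0 (by simp))

/-! ### The induced module is isomorphic to the model -/

theorem quadOp_eq {d : ℕ} (r : ℂ) (p q : Fin d × ℤ) (f : Pol d) :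
    quadOp r p q f = modelRep d r (vpL r p q) f - ((1 - r) * vev d (vp p q)) • f := by
  rw [modelRep_vpL, LinearMap.add_apply, LinearMap.smul_apply, Module.End.one_apply,
    add_sub_cancel_right]

theorem toModel_surjective {d : ℕ} {r : ℂ} (hr : ∀ k : ℤ, r ≠ k) :
    Function.Surjective (toModel d r) := by
  rw [← LinearMap.range_eq_top]
  refine eq_top_of_one_mem hr ?_ ⟨vac d r, toModel_vac d r⟩
  rintro p q _ ⟨m, rfl⟩
  rw [quadOp_eq, ← toModel_lie]
  exact sub_mem ⟨_, rfl⟩ (Submodule.smul_mem _ _ ⟨m, rfl⟩)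

theorem riccati_cre_cre_mem {d : ℕ} (a b : Fin d × ℕ) (e : Sym2 (Fin d × ℕ) →₀ ℕ) :
    riccati (cre a) (cre b) (monomial e 1) ∈ wtSpace (a ::ₘ b ::ₘ pairWt e) := by
  induction e using finsupp_add_single_induction with
  | h0 =>
    have : riccati (cre a) (cre b) (monomial 0 1) = 0 :=
      (riccati (cre a) (cre b)).map_one_eq_zero
    rw [this]
    exact zero_mem _
  | h e s ih =>
    induction s with | _ x y
    have h0 := monomial_mem_wtSpace e
    have h1 := X_mul_mem_wtSpace x y ih
    have h2 := X_mul_mem_wtSpace a x (X_mul_mem_wtSpace b y h0)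
    have h3 := X_mul_mem_wtSpace b x (X_mul_mem_wtSpace a y h0)
    rw [Multiset.cons_swap y a, Multiset.cons_swap y b, Multiset.cons_swap x a,
      Multiset.cons_swap x b] at h1
    rw [Multiset.cons_swap x b] at h2
    rw [Multiset.cons_swap x a, Multiset.cons_swap b a] at h3
    have : riccati (cre a) (cre b) (monomial (e + Finsupp.single s(x, y) 1) 1) =
        X s(x, y) * riccati (cre a) (cre b) (monomial e 1) +
        (X s(a, x) * (X s(b, y) * monomial e 1) + X s(b, x) * (X s(a, y) * monomial e 1)) := by
      rw [monomial_add_single_eq, Derivation.leibniz, riccati_X, contr_cre_cre, contr_cre_cre,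
        contr_cre_cre, contr_cre_cre]
      simp only [smul_eq_mul]
      ring
    rw [this, pairWt_add_single]
    exact add_mem h1 (add_mem h2 h3)

theorem quadOp_cre_cre_mem {d : ℕ} (r : ℂ) (a b : Fin d × ℕ) {m : Multiset (Fin d × ℕ)}
    {f : Pol d} (hf : f ∈ wtSpace m) : quadOp r (cre a) (cre b) f ∈ wtSpace (a ::ₘ b ::ₘ m) := by
  rw [quadOp_apply, contr_cre_cre, mul_assoc, ← smul_eq_C_mul]
  refine add_mem ?_ (Submodule.smul_mem _ _ (X_mul_mem_wtSpace a b hf))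
  have h : wtSpace m ≤ (wtSpace (a ::ₘ b ::ₘ m)).comap (riccati (cre a) (cre b)).toLinearMap :=
    wtSpace_le fun e he => he ▸ riccati_cre_cre_mem a b e
  exact h hf

/-- The composite of the parametrization of `M_r` with the map to the model. -/
def polToModel (d : ℕ) (r : ℂ) : Pol d →ₗ[ℂ] Pol d := toModel d r ∘ₗ fromPol d r

theorem polToModel_monomial_mem {d : ℕ} (r : ℂ) (e : Sym2 (Fin d × ℕ) →₀ ℕ) :
    polToModel d r (monomial e 1) ∈ wtSpace (pairWt e) := by
  induction e using finsupp_add_single_induction with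
  | h0 =>
    change toModel d r (fromPol d r 1) ∈ _
    rw [fromPol_one, toModel_vac]
    exact monomial_mem_wtSpace 0
  | h e s ih =>
    induction s with | _ a b
    rw [monomial_add_single_eq, polToModel, LinearMap.comp_apply, fromPol_X_mul, toModel_lie,
      modelRep_vpL, vev_vp_left_neg (cre_neg a), mul_zero, zero_smul, add_zero, pairWt_add_single]
    exact quadOp_cre_cre_mem r a b ih

theorem polToModel_mem {d : ℕ} (r : ℂ) {m : Multiset (Fin d × ℕ)} {f : Pol d}
    (hf : f ∈ wtSpace m) : polToModel d r f ∈ wtSpace m := by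
  have h : wtSpace m ≤ (wtSpace m).comap (polToModel d r) :=
    wtSpace_le fun e he => he ▸ polToModel_monomial_mem r e
  exact h hf

theorem weightedHomogeneousComponent_polToModel {d : ℕ} (r : ℂ) (m : Multiset (Fin d × ℕ))
    (f : Pol d) : weightedHomogeneousComponent Sym2.toMultiset m (polToModel d r f) =
      polToModel d r (weightedHomogeneousComponent Sym2.toMultiset m f) := by
  have h : weightedHomogeneousComponent Sym2.toMultiset m ∘ₗ polToModel d r =
      polToModel d r ∘ₗ weightedHomogeneousComponent Sym2.toMultiset m := by
    refine (basisMonomials _ ℂ).ext fun e => ?_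
    rw [coe_basisMonomials, LinearMap.comp_apply, LinearMap.comp_apply,
      weightedHomogeneousComponent_of_mem (polToModel_monomial_mem r e),
      weightedHomogeneousComponent_of_mem (monomial_mem_wtSpace e)]
    split_ifs
    · rfl
    · rw [map_zero]
  exact LinearMap.congr_fun h f

/-- Surjectivity passes to each finite-dimensional weight space by projecting a preimage to its
component of that weight, and there it implies injectivity. -/
theorem polToModel_injective {d : ℕ} {r : ℂ} (hr : ∀ k : ℤ, r ≠ k) :
    Function.Injective (polToModel d r) := by
  have hinj : ∀ m : Multiset (Fin d × ℕ), ∀ f ∈ wtSpace m, polToModel d r f = 0 → f = 0 := by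
    intro m f hf hf0
    have hmap : ∀ f ∈ wtSpace m, polToModel d r f ∈ wtSpace m := fun f => polToModel_mem r
    have hsurj : Function.Surjective ((polToModel d r).restrict hmap) := by
      rintro ⟨g, hg⟩
      obtain ⟨w, rfl⟩ := toModel_surjective hr g
      obtain ⟨f, rfl⟩ := fromPol_surjective d r w
      refine ⟨⟨weightedHomogeneousComponent Sym2.toMultiset m f,
        weightedHomogeneousComponent_mem _ _ _⟩, Subtype.ext ?_⟩
      change polToModel d r (weightedHomogeneousComponent Sym2.toMultiset m f) =
        toModel d r (fromPol d r f)
      rw [← weightedHomogeneousComponent_polToModel]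
      exact weightedHomogeneousComponent_eq_self hg
    have h := LinearMap.injective_iff_surjective.mpr hsurj
    have h2 : (⟨f, hf⟩ : wtSpace m) = 0 := h (Subtype.ext (by
      change polToModel d r f = polToModel d r 0
      rw [hf0, map_zero]))
    exact congrArg Subtype.val h2
  rw [injective_iff_map_eq_zero]
  intro f hf
  ext e
  have h := hinj (pairWt e) (weightedHomogeneousComponent Sym2.toMultiset (pairWt e) f)
    (weightedHomogeneousComponent_mem _ _ _) (by
      rw [← weightedHomogeneousComponent_polToModel, hf, map_zero])
  have h2 := congrArg (coeff e) h
  rwa [coeff_weightedHomogeneousComponent,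
    if_pos (show Finsupp.weight Sym2.toMultiset e = pairWt e from rfl)] at h2

theorem toModel_injective {d : ℕ} {r : ℂ} (hr : ∀ k : ℤ, r ≠ k) :
    Function.Injective (toModel d r) := by
  intro x y hxy
  obtain ⟨f, rfl⟩ := fromPol_surjective d r x
  obtain ⟨g, rfl⟩ := fromPol_surjective d r y
  rw [polToModel_injective hr hxy]

/-! ### Irreducibility -/

/-- Polynomials in the variables with both indices in the `i`-th family. -/
def polOne (d : ℕ) (i : Fin d) : Subalgebra ℂ (Pol d) :=
  supported ℂ {s : Sym2 (Fin d × ℕ) | ∀ x ∈ s, x.1 = i}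

theorem contr_mem_polOne {d : ℕ} {i : Fin d} {p q : Fin d × ℤ} (hp : p.1 = i) (hq : q.1 = i) :
    contr p q ∈ polOne d i := by
  rw [contr]
  split_ifs
  · refine X_mem_supported.mpr fun x hx => ?_
    rcases Sym2.mem_iff.mp hx with rfl | rfl
    · exact hp
    · exact hq
  · exact (polOne d i).algebraMap_mem _
  · exact zero_mem _

theorem riccati_mem_polOne {d : ℕ} {i : Fin d} {p q : Fin d × ℤ} (hp : p.1 = i) (hq : q.1 = i)
    {f : Pol d} (hf : f ∈ polOne d i) : riccati p q f ∈ polOne d i := by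
  rw [polOne, supported] at hf
  induction hf using Algebra.adjoin_induction with
  | mem x hx =>
    obtain ⟨s, hs, rfl⟩ := hx
    induction s with | _ a b
    have ha : (cre a).1 = i := hs a (by simp)
    have hb : (cre b).1 = i := hs b (by simp)
    rw [riccati_X]
    exact add_mem (mul_mem (contr_mem_polOne hp ha) (contr_mem_polOne hq hb))
      (mul_mem (contr_mem_polOne hq ha) (contr_mem_polOne hp hb))
  | algebraMap c =>
    rw [Derivation.map_algebraMap]
    exact zero_mem _
  | add x y _ _ hx hy =>
    rw [map_add]
    exact add_mem hx hy
  | mul x y hx hy ihx ihy =>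
    rw [Derivation.leibniz]
    exact add_mem (mul_mem hx ihy) (mul_mem hy ihx)

theorem quadOp_mem_polOne {d : ℕ} (r : ℂ) {i : Fin d} {p q : Fin d × ℤ} (hp : p.1 = i)
    (hq : q.1 = i) {f : Pol d} (hf : f ∈ polOne d i) : quadOp r p q f ∈ polOne d i := by
  rw [quadOp_apply, mul_assoc, ← smul_eq_C_mul]
  exact add_mem (riccati_mem_polOne hp hq hf)
    (Subalgebra.smul_mem _ (mul_mem (contr_mem_polOne hp hq) hf) r)

theorem modelRep_mem_polOne {d : ℕ} {r : ℂ} {i : Fin d} {x : LieLr d r} (hx : x ∈ LrOne d r i) :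
    ∀ f ∈ polOne d i, modelRep d r x f ∈ polOne d i := by
  let S : LieSubalgebra ℂ (LieLr d r) :=
    { carrier := {x | ∀ f ∈ polOne d i, modelRep d r x f ∈ polOne d i}
      zero_mem' := by
        intro f _
        rw [map_zero]
        exact zero_mem _
      add_mem' := by
        intro x y hx hy f hf
        rw [map_add]
        exact add_mem (hx f hf) (hy f hf)
      smul_mem' := by
        intro c x hx f hf
        rw [map_smul]
        exact Subalgebra.smul_mem _ (hx f hf) c
      lie_mem' := by
        intro x y hx hy f hf
        rw [LieHom.map_lie, LieRing.of_associative_ring_bracket]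
        exact sub_mem (hx _ (hy f hf)) (hy _ (hx f hf)) }
  have h : LrOne d r i ≤ S := by
    rw [LrOne, LieSubalgebra.lieSpan_le]
    rintro _ ⟨m, n, -, rfl⟩ f hf
    change modelRep d r (vpL r (i, m) (i, n)) f ∈ _
    rw [modelRep_vpL, LinearMap.add_apply, LinearMap.smul_apply, Module.End.one_apply]
    have h1 := quadOp_mem_polOne r (p := (i, m)) (q := (i, n)) rfl rfl hf
    have h2 := (polOne d i).smul_mem hf ((1 - r) * vev d (vp (i, m) (i, n)))
    exact add_mem h1 h2
  exact h hx

theorem envIncl_smul_mem {d : ℕ} {r : ℂ} {i : Fin d} (P : Submodule ℂ (Mr d r))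
    (hP : ∀ x ∈ LrOne d r i, ∀ m ∈ P, ⁅x, m⁆ ∈ P)
    (u : UniversalEnvelopingAlgebra ℂ (LrOne d r i)) :
    ∀ m ∈ P, envIncl (LrOne d r i) u • m ∈ P := by
  let S : Subalgebra ℂ (UniversalEnvelopingAlgebra ℂ (LrOne d r i)) :=
    { carrier := {u | ∀ m ∈ P, envIncl (LrOne d r i) u • m ∈ P}
      mul_mem' := by
        intro a b ha hb m hm
        rw [map_mul, mul_smul]
        exact ha _ (hb _ hm)
      add_mem' := by
        intro a b ha hb m hm
        rw [map_add, add_smul]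
        exact add_mem (ha _ hm) (hb _ hm)
      algebraMap_mem' := by
        intro c m hm
        rw [AlgHom.commutes, algebraMap_smul]
        exact P.smul_mem c hm }
  refine uea_mem S (fun x m hm => ?_) u
  rw [envIncl_ι]
  exact hP x x.2 m hm

theorem toModel_mem_polOne {d : ℕ} {r : ℂ} {i : Fin d} {w : Mr d r} (hw : w ∈ MrOne d r i) :
    toModel d r w ∈ polOne d i := by
  obtain ⟨u, rfl⟩ := hw
  refine envIncl_smul_mem ((Subalgebra.toSubmodule (polOne d i)).comap (toModel d r)) ?_ u _ ?_
  · intro x hx m hm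
    change toModel d r ⁅x, m⁆ ∈ polOne d i
    rw [toModel_lie]
    exact modelRep_mem_polOne hx _ hm
  · change toModel d r (vac d r) ∈ polOne d i
    rw [toModel_vac]
    exact one_mem _

theorem riccati_ann_ann {d : ℕ} (a b : Fin d × ℕ) :
    ∃ c : ℂ, c ≠ 0 ∧ riccati (ann a) (ann b) = c • pderiv s(a, b) := by
  have ha : ((a.2 : ℂ) + 1) ≠ 0 := Nat.cast_add_one_ne_zero _
  have hb : ((b.2 : ℂ) + 1) ≠ 0 := Nat.cast_add_one_ne_zero _
  -- The first two factors are the pairings of the modes with their duals; the $2$ arises because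
  -- both Wick terms contribute on the diagonal.
  refine ⟨((a.2 : ℂ) + 1) * ((b.2 : ℂ) + 1) * (if a = b then 2 else 1), ?_, ?_⟩
  · refine mul_ne_zero (mul_ne_zero ha hb) ?_
    split_ifs <;> norm_num
  · apply derivation_ext
    rintro ⟨x, y⟩
    change riccati _ _ (X s(x, y)) = (_ • pderiv s(a, b)) (X s(x, y))
    rw [riccati_X, Derivation.smul_apply, pderiv_X, contr_ann_cre, contr_ann_cre, contr_ann_cre,
      contr_ann_cre, Pi.single_apply, smul_eq_C_mul]
    by_cases hab : a = b
    · subst hab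
      by_cases hx : a = x <;> by_cases hy : a = y
      · subst hx hy
        have h2 : (C 2 : Pol d) = 2 := map_ofNat C 2
        simp [h2]
        ring
      · subst hx
        simp [hy, Ne.symm hy]
      · subst hy
        simp [hx, Ne.symm hx]
      · simp [hx, hy, Ne.symm hx]
    · by_cases hx : a = x <;> by_cases hy : b = y
      · subst hx hy
        simp [hab, Ne.symm hab]
      · subst hx
        simp [hab, hy, Ne.symm hab, Ne.symm hy]
      · subst hy
        simp [hab, hx, Ne.symm hab, Ne.symm hx]
      · by_cases hx' : b = x <;> by_cases hy' : a = y
        · subst hx' hy'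
          simp [hab, Ne.symm hab]
          ring
        · subst hx'
          simp [hab, Ne.symm hab, hy', Ne.symm hy']
        · subst hy'
          simp [hab, Ne.symm hab, hx', Ne.symm hx']
        · simp [hab, hx, hy, hx', hy', Ne.symm hx, Ne.symm hx']

theorem modelRep_ann_ann {d : ℕ} (r : ℂ) (a b : Fin d × ℕ) (f : Pol d) :
    modelRep d r (vpL r (ann a) (ann b)) f = riccati (ann a) (ann b) f := by
  have h : (0 : ℤ) ≤ (ann b).2 := by
    simp only [ann]
    omega
  rw [modelRep_vpL, vev_vp_right_nonneg _ h, mul_zero, zero_smul, add_zero, quadOp_apply,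
    contr_right_nonneg h]
  ring

theorem vpL_ann_ann_mem {d : ℕ} (r : ℂ) {i : Fin d} {a b : Fin d × ℕ} (ha : a.1 = i)
    (hb : b.1 = i) (hab : a.2 ≤ b.2) : vpL r (ann a) (ann b) ∈ LrOne d r i := by
  refine LieSubalgebra.subset_lieSpan ⟨(ann a).2, (ann b).2, ?_, ?_⟩
  · simp only [ann]
    omega
  · obtain ⟨_, k⟩ := a
    obtain ⟨_, l⟩ := b
    subst ha
    simp only at hb
    subst hb
    rfl

theorem exists_lowering {d : ℕ} {r : ℂ} {i : Fin d} (s : Sym2 (Fin d × ℕ))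
    (hs : ∀ x ∈ s, x.1 = i) :
    ∃ x ∈ LrOne d r i, ∃ c : ℂ, c ≠ 0 ∧ ∀ f, modelRep d r x f = c • pderiv s f := by
  have key : ∀ a b : Fin d × ℕ, a.1 = i → b.1 = i → a.2 ≤ b.2 →
      ∃ x ∈ LrOne d r i, ∃ c : ℂ, c ≠ 0 ∧ ∀ f, modelRep d r x f = c • pderiv s(a, b) f := by
    intro a b ha hb hab
    obtain ⟨c, hc, h⟩ := riccati_ann_ann a b
    refine ⟨_, vpL_ann_ann_mem r ha hb hab, c, hc, fun f => ?_⟩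
    rw [modelRep_ann_ann, h, Derivation.smul_apply]
  induction s with | _ a b
  have ha := hs a (by simp)
  have hb := hs b (by simp)
  rcases le_total a.2 b.2 with h | h
  · exact key a b ha hb h
  · rw [Sym2.eq_swap]
    exact key b a hb ha h

/-- Differentiation in the model, carried back to $M_r$ by injectivity of `toModel`, with induction
on a degree bound for the image. The inclusion in `MrOne` ensures that every variable that occurs
has its derivative available in `LrOne`. -/
theorem vac_mem_of_stable {d : ℕ} {r : ℂ} (hr : ∀ k : ℤ, r ≠ k) {i : Fin d}
    {P : Submodule ℂ (Mr d r)} (hP : ∀ x ∈ LrOne d r i, ∀ m ∈ P, ⁅x, m⁆ ∈ P)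
    (hle : ∀ m ∈ P, m ∈ MrOne d r i) (n : ℕ) : ∀ w ∈ P, w ≠ 0 →
    (∀ e, coeff e (toModel d r w) ≠ 0 → e.degree ≤ n) → vac d r ∈ P := by
  induction n with
  | zero =>
    intro w hw hw0 hn
    have h : toModel d r w = C (coeff 0 (toModel d r w)) := by
      ext e
      rw [coeff_C]
      split_ifs with he
      · rw [he]
      · by_contra hne
        exact he ((Finsupp.degree_eq_zero_iff e).mp (Nat.le_zero.mp (hn e hne))).symm
    set c := coeff 0 (toModel d r w) with hc
    have h2 : w = c • vac d r := by
      apply toModel_injective hr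
      rw [map_smul, toModel_vac, h, smul_eq_C_mul, mul_one]
    have hc0 : c ≠ 0 := by
      intro h0
      rw [h0, zero_smul] at h2
      exact hw0 h2
    have h3 := P.smul_mem c⁻¹ hw
    rwa [h2, smul_smul, inv_mul_cancel₀ hc0, one_smul] at h3
  | succ n ih =>
    intro w hw hw0 hn
    by_cases hall : ∀ e, coeff e (toModel d r w) ≠ 0 → e.degree ≤ n
    · exact ih w hw hw0 hall
    push Not at hall
    obtain ⟨e, he, hen⟩ := hall
    have he0 : e ≠ 0 := by
      rintro rfl
      simp at hen
    obtain ⟨s, hs⟩ := Finsupp.ne_iff.mp he0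
    have hsv : s ∈ (toModel d r w).vars :=
      mem_vars_iff_mem_support s |>.mpr
        ⟨e, mem_support_iff.mpr he, Finsupp.mem_support_iff.mpr hs⟩
    -- A variable `s` of a monomial of degree above `n` has both indices in family `i`;
    -- differentiating in `s` keeps that monomial nonzero and lowers the bound.
    have hsi := mem_supported.mp (toModel_mem_polOne (hle w hw)) hsv
    obtain ⟨x, hx, c, hc, hxc⟩ := exists_lowering (r := r) s hsi
    obtain ⟨e', rfl⟩ := exists_eq_add_single hs
    have hcoeff : ∀ e', coeff e' (toModel d r ⁅x, w⁆) =
        c * (coeff (e' + Finsupp.single s 1) (toModel d r w) * ((e' s : ℂ) + 1)) := by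
      intro e'
      rw [toModel_lie, hxc, coeff_smul, coeff_pderiv, smul_eq_mul]
    refine ih ⁅x, w⁆ (hP x hx w hw) ?_ ?_
    · intro h0
      have h1 := hcoeff e'
      rw [h0, map_zero, coeff_zero] at h1
      exact mul_ne_zero hc (mul_ne_zero he (Nat.cast_add_one_ne_zero _)) h1.symm
    · intro e' h0
      rw [hcoeff] at h0
      have := hn _ (left_ne_zero_of_mul (right_ne_zero_of_mul h0))
      rw [map_add, Finsupp.degree_single] at this
      omega

theorem vac_mem_MrOne {d : ℕ} (r : ℂ) (i : Fin d) : vac d r ∈ MrOne d r i :=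
  ⟨1, by rw [map_one, one_smul]⟩

theorem isIrreducible_MrOne {d : ℕ} {r : ℂ} (hr : ∀ k : ℤ, r ≠ k) (i : Fin d) :
    LieModule.IsIrreducible ℂ (LrOne d r i) (MrOne d r i) := by
  have : Nontrivial (MrOne d r i) := by
    refine ⟨⟨vac d r, vac_mem_MrOne r i⟩, 0, fun h => ?_⟩
    have h2 : vac d r = 0 := congrArg Subtype.val h
    have h3 := toModel_vac d r
    rw [h2, map_zero] at h3
    exact zero_ne_one h3
  refine LieModule.IsIrreducible.mk fun N hN => ?_
  let P : Submodule ℂ (Mr d r) := N.toSubmodule.map (MrOne d r i).toSubmodule.subtype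
  have hP : ∀ x ∈ LrOne d r i, ∀ m ∈ P, ⁅x, m⁆ ∈ P := by
    rintro x hx _ ⟨m, hm, rfl⟩
    exact ⟨(⁅(⟨x, hx⟩ : LrOne d r i), (m : MrOne d r i)⁆ : MrOne d r i), N.lie_mem hm, rfl⟩
  have hle : ∀ m ∈ P, m ∈ MrOne d r i := by
    rintro _ ⟨m, -, rfl⟩
    exact m.2
  obtain ⟨w, hwN, hw0⟩ : ∃ w ∈ N, w ≠ 0 := by
    by_contra! h
    exact hN ((LieSubmodule.eq_bot_iff N).mpr h)
  have hvac : vac d r ∈ P := by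
    refine vac_mem_of_stable hr hP hle (toModel d r w).totalDegree w ⟨w, hwN, rfl⟩
      (fun h => hw0 (Subtype.ext h)) fun e he => ?_
    exact le_totalDegree (mem_support_iff.mpr he)
  rw [eq_top_iff]
  rintro ⟨_, u, rfl⟩ -
  -- Every element of `MrOne` is `u` applied to the vacuum, so it lies in the submodule as soon as
  -- the vacuum does.
  obtain ⟨m, hm, hmu⟩ := envIncl_smul_mem P hP u _ hvac
  have : m = ⟨_, u, rfl⟩ := Subtype.ext hmu
  exact this ▸ hm

end AshiharaMiyamoto

end

theorem proposition5p1 (d : ℕ) (hd : 2 ≤ d) (r : ℂ) (hr : ∀ k : ℤ, r ≠ (k : ℂ)) :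
    LieModule.IsIrreducible ℂ
      (AshiharaMiyamoto.LrOne d r (⟨0, Nat.lt_of_lt_of_le Nat.zero_lt_two hd⟩ : Fin d))
      (AshiharaMiyamoto.MrOne d r (⟨0, Nat.lt_of_lt_of_le Nat.zero_lt_two hd⟩ : Fin d)) := by
  exact AshiharaMiyamoto.isIrreducible_MrOne hr _
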